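/- Let $\mathcal E$ be a finite-dimensional real vector space with an inner product $\langle\cdot,\cdot\rangle$ and a norm $\|\cdot\|$ (not necessarily induced by the inner product), with dual norm $\|x\|_*=\sup_{\|y\|\le1}\langle x,y\rangle$. Let $Z\subseteq\mathcal E$ be non-empty, closed and convex, and let $L_G,L_H\ge0$. Let $G$ be continuously differentiable on $Z$ with $0\le G(w)-G(v)-\langle\nabla G(v),w-v\rangle\le\frac{L_G}{2}\|w-v\|^2$ for all $w,v\in Z$; let $H:Z\to\mathcal E$ satisfy $\langle H(w)-H(v),w-v\rangle\ge0$ and $\|H(w)-H(v)\|_*\le L_H\|w-v\|$ for all $w,v\in Z$; let $J:Z\to\mathbb R$ be convex and lower semicontinuous. Put $$Q(\tilde u,u)=G(\tilde u)-G(u)+\langle H(u),\tilde u-u\rangle+J(\tilde u)-J(u),\qquad g(\tilde u)=\sup_{u\in Z}Q(\tilde u,u).$$ Let $\omega$ be differentiable and strongly convex on $Z$ with parameter $\mu>0$ with respect to $\|\cdot\|$, let $V(z,u)=\omega(u)-\omega(z)-\langle\nabla\omega(z),u-z\rangle$, and let $\Omega_Z>0$ satisfy $\sup_{z_1,z_2\in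 Z}V(z_1,z_2)\le\Omega_Z^2$ (so that $Z$ is bounded). Write $P_z^{J}(\eta)=\operatorname{argmin}_{u\in Z}\{\langle\eta,u-z\rangle+V(z,u)+J(u)\}$. Let $\xi_i,\zeta_i$ ($i\ge1$) be mutually independent random variables, and let the (jointly measurable) oracles $\mathcal G,\mathcal H$ be unbiased: $\mathbb E[\mathcal G(x,\xi_i)]=\nabla G(x)$ and $\mathbb E[\mathcal H(x,\zeta_i)]=H(x)$ for all $x\in Z$, $i\ge1$. Let $\sigma_G,\sigma_H\ge0$ and $\sigma=\sqrt{\sigma_H^2+\sigma_G^2}$, where $L_G,L_H,\sigma$ are not all zero. Stochastic AMP starts from $r_1\in Z$, $w_1=w_1^{ag}=r_1$, and computes for $t=1,2,\dots$ $$\begin{aligned}w_t^{md}&=(1-\alpha_t)w_t^{ag}+\alpha_tr_t,\\ w_{t+1}&=P_{r_t}^{\gamma_tJ}\big(\gamma_t\mathcal H(r_t,\zeta_{2t-1})+\gamma_t\mathcal G(w_t^{md},\xi_t)\big),\\ r_{t+1}&=P_{r_t}^{\gamma_tJ}\big(\gamma_t\mathcal H(w_{t+1},\zeta_{2t})+\gamma_t\mathcal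 G(w_t^{md},\xi_t)\big),\\ w_{t+1}^{ag}&=(1-\alpha_t)w_t^{ag}+\alpha_tw_{t+1},\end{aligned}$$ with stepsizes $$\alpha_t=\frac2{t+1},\qquad\gamma_t=\frac{\mu t}{4L_G+3L_Ht+\sigma(t+1)\sqrt{\mu t}/(\sqrt2\,\Omega_Z)}.$$ Then $g$ is finite on $Z$, and the following hold. (a) If $\mathbb E\|\mathcal G(x,\xi_i)-\nabla G(x)\|_*^2\le\sigma_G^2$ and $\mathbb E\|\mathcal H(x,\zeta_i)-H(x)\|_*^2\le\sigma_H^2$ for all $x\in Z$ and $i\ge1$, then for every $t\ge2$ the random variable $g(w_{t+1}^{ag})$ is integrable and $$\mathbb E\big[g(w_{t+1}^{ag})\big]\le\mathcal C_0(t):=\frac{16L_G\Omega_Z^2}{\mu t(t+1)}+\frac{12L_H\Omega_Z^2}{\mu(t+1)}+\frac{7(\sigma_G+\sigma_H)\Omega_Z}{\sqrt{\mu(t-1)}}.$$ (b) If $\mathbb E\exp\{\|\mathcal G(x,\xi_i)-\nabla G(x)\|_*^2/\sigma_G^2\}\le\exp\{1\}$ and $\mathbb E\exp\{\|\mathcal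 H(x,\zeta_i)-H(x)\|_*^2/\sigma_H^2\}\le\exp\{1\}$ for all $x\in Z$ and $i\ge1$ (with $0/0=0$ and $a/0=+\infty$ for $a>0$), then for every $t\ge2$ and every $\lambda>0$ $$\mathrm{Prob}\big\{g(w_{t+1}^{ag})>\mathcal C_0(t)+\lambda\,\mathcal C_1(t)\big\}\le2\exp\{-\lambda^2/3\}+3\exp\{-\lambda\},\qquad\mathcal C_1(t):=\frac{6(\sigma_G+\sigma_H)\Omega_Z}{\sqrt{\mu(t-1)}}.$$ -/

import Mathlib

open MeasureTheory ProbabilityTheory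

/-- `ip x y = ⟨x, y⟩` is an inner product on `E`; it need not induce the norm of `E`. -/
structure IsInnerProduct {E : Type*} [NormedAddCommGroup E] [NormedSpace ℝ E]
    (ip : E →L[ℝ] E →L[ℝ] ℝ) : Prop where
  symm : ∀ x y, ip x y = ip y x
  pos : ∀ x, x ≠ 0 → 0 < ip x x

/-- The norm `‖x‖_* = sup {⟨x, y⟩ : ‖y‖ ≤ 1}` dual to the norm of `E`, i.e. the operator norm of
the functional `⟨x, ·⟩`. -/
noncomputable def dualNorm {E : Type*} [NormedAddCommGroup E] [NormedSpace ℝ E]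
    (ip : E →L[ℝ] E →L[ℝ] ℝ) (x : E) : ℝ :=
  ‖ip x‖

/-- `dgf` is strongly convex on `Z` with parameter `μ > 0` with respect to the norm of `E`, and
differentiable on `Z` with gradient `gradDgf`. -/
structure IsDistanceGenerating {E : Type*} [NormedAddCommGroup E] [NormedSpace ℝ E]
    (ip : E →L[ℝ] E →L[ℝ] ℝ) (Z : Set E) (μ : ℝ) (dgf : E → ℝ) (gradDgf : E → E) : Prop where
  mu_pos : 0 < μ
  strongConvex : StrongConvexOn Z μ dgf
  hasGradient : ∀ z ∈ Z, HasFDerivWithinAt dgf (ip (gradDgf z)) Z z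

/-- The prox-function `V(z, u) = ω(u) - ω(z) - ⟨∇ω(z), u - z⟩`. -/
noncomputable def bregman {E : Type*} [NormedAddCommGroup E] [NormedSpace ℝ E]
    (ip : E →L[ℝ] E →L[ℝ] ℝ) (dgf : E → ℝ) (gradDgf : E → E) (z u : E) : ℝ :=
  dgf u - dgf z - ip (gradDgf z) (u - z)

/-- `w = P_z^J(η)`, that is, `w` minimizes `⟨η, u - z⟩ + V(z, u) + J(u)` over `u ∈ Z`. -/
def IsProx {E : Type*} [NormedAddCommGroup E] [NormedSpace ℝ E]
    (ip : E →L[ℝ] E →L[ℝ] ℝ) (Z : Set E) (dgf : E → ℝ) (gradDgf : E → E)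
    (J : E → ℝ) (z η w : E) : Prop :=
  w ∈ Z ∧ IsMinOn (fun u => ip η (u - z) + bregman ip dgf gradDgf z u + J u) Z w

/-- The data of the variational inequality `VI(Z; G, H, J)`. -/
structure IsVIProblem {E : Type*} [NormedAddCommGroup E] [NormedSpace ℝ E]
    (ip : E →L[ℝ] E →L[ℝ] ℝ) (Z : Set E) (G : E → ℝ) (gradG H : E → E) (J : E → ℝ)
    (LG LH : ℝ) : Prop where
  nonempty : Z.Nonempty
  isClosed : IsClosed Z
  convex : Convex ℝ Z
  LG_nonneg : 0 ≤ LG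
  LH_nonneg : 0 ≤ LH
  hasGradient : ∀ v ∈ Z, HasFDerivWithinAt G (ip (gradG v)) Z v
  continuousOn_grad : ContinuousOn gradG Z
  bregman_nonneg : ∀ w ∈ Z, ∀ v ∈ Z, 0 ≤ G w - G v - ip (gradG v) (w - v)
  bregman_le : ∀ w ∈ Z, ∀ v ∈ Z, G w - G v - ip (gradG v) (w - v) ≤ LG / 2 * ‖w - v‖ ^ 2
  monotone : ∀ w ∈ Z, ∀ v ∈ Z, 0 ≤ ip (H w - H v) (w - v)
  lipschitz : ∀ w ∈ Z, ∀ v ∈ Z, dualNorm ip (H w - H v) ≤ LH * ‖w - v‖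
  convexJ : ConvexOn ℝ Z J
  lscJ : LowerSemicontinuousOn J Z

/-- `Q(ũ, u) = G(ũ) - G(u) + ⟨H(u), ũ - u⟩ + J(ũ) - J(u)`. -/
noncomputable def viQ {E : Type*} [NormedAddCommGroup E] [NormedSpace ℝ E]
    (ip : E →L[ℝ] E →L[ℝ] ℝ) (G : E → ℝ) (H : E → E) (J : E → ℝ) (x u : E) : ℝ :=
  G x - G u + ip (H u) (x - u) + J x - J u

/-- The gap function `g(ũ) = sup_{u ∈ Z} Q(ũ, u)`. -/
noncomputable def viGap {E : Type*} [NormedAddCommGroup E] [NormedSpace ℝ E]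
    (ip : E →L[ℝ] E →L[ℝ] ℝ) (Z : Set E) (G : E → ℝ) (H : E → E) (J : E → ℝ) (x : E) : ℝ :=
  sSup ((fun u => viQ ip G H J x u) '' Z)

/-- The stochastic oracle whose `i`-th call (`i ≥ 1`) with input `x ∈ Z` outputs `Fs x (ξ i)`, is
an unbiased estimator of `F` on `Z`. -/
structure IsUnbiasedOracle {E Ω Ξ : Type*} [NormedAddCommGroup E] [NormedSpace ℝ E]
    [MeasurableSpace E] [MeasurableSpace Ω] [MeasurableSpace Ξ] (P : Measure Ω)
    (Z : Set E) (F : E → E) (Fs : E → Ξ → E) (ξ : ℕ → Ω → Ξ) : Prop where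
  measurable : Measurable (Function.uncurry Fs)
  integrable : ∀ i, 1 ≤ i → ∀ x ∈ Z, Integrable (fun ω => Fs x (ξ i ω)) P
  unbiased : ∀ i, 1 ≤ i → ∀ x ∈ Z, ∫ ω, Fs x (ξ i ω) ∂P = F x

/-- `E[‖F(x, ξ_i) - F(x)‖_*²] ≤ σ²` for every call `i ≥ 1` and every input `x ∈ Z`. -/
def HasBoundedVariance {E Ω Ξ : Type*} [NormedAddCommGroup E] [NormedSpace ℝ E]
    [MeasurableSpace Ω] (P : Measure Ω) (ip : E →L[ℝ] E →L[ℝ] ℝ)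
    (Z : Set E) (F : E → E) (Fs : E → Ξ → E) (ξ : ℕ → Ω → Ξ) (σ : ℝ) : Prop :=
  ∀ i, 1 ≤ i → ∀ x ∈ Z,
    ∫⁻ ω, ENNReal.ofReal (dualNorm ip (Fs x (ξ i ω) - F x) ^ 2) ∂P ≤ ENNReal.ofReal (σ ^ 2)

/-- `E[exp(‖F(x, ξ_i) - F(x)‖_*² / σ²)] ≤ exp 1` for every call `i ≥ 1` and every input `x ∈ Z`.
For `σ = 0` the quotient is read with `0 / 0 = 0` and `a / 0 = ∞` for `a > 0`, so that the
condition says that the oracle is exact almost surely. -/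
def HasLightTail {E Ω Ξ : Type*} [NormedAddCommGroup E] [NormedSpace ℝ E]
    [MeasurableSpace Ω] (P : Measure Ω) (ip : E →L[ℝ] E →L[ℝ] ℝ)
    (Z : Set E) (F : E → E) (Fs : E → Ξ → E) (ξ : ℕ → Ω → Ξ) (σ : ℝ) : Prop :=
  ∀ i, 1 ≤ i → ∀ x ∈ Z,
    (∫⁻ ω, ENNReal.ofReal (Real.exp (dualNorm ip (Fs x (ξ i ω) - F x) ^ 2 / σ ^ 2)) ∂P
      ≤ ENNReal.ofReal (Real.exp 1)) ∧
    (σ = 0 → ∀ᵐ ω ∂P, Fs x (ξ i ω) = F x)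

/-- The processes `r`, `w`, `wag`, `wmd` (indexed from `1`) are generated by the stochastic
accelerated mirror-prox method with initial point `r₁`, stepsizes `α`, `γ` and stochastic oracles
`Gs`, `Hs`. -/
structure IsStochasticAMP {E Ω Ξ : Type*} [NormedAddCommGroup E] [NormedSpace ℝ E]
    (ip : E →L[ℝ] E →L[ℝ] ℝ) (Z : Set E) (dgf : E → ℝ) (gradDgf : E → E) (J : E → ℝ)
    (Gs Hs : E → Ξ → E) (ξ ζ : ℕ → Ω → Ξ) (α γ : ℕ → ℝ) (r₁ : E)
    (r w wag wmd : ℕ → Ω → E) : Prop where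
  init_mem : r₁ ∈ Z
  init_r : ∀ ω, r 1 ω = r₁
  init_w : ∀ ω, w 1 ω = r₁
  init_wag : ∀ ω, wag 1 ω = r₁
  step_wmd : ∀ t, 1 ≤ t → ∀ ω, wmd t ω = (1 - α t) • wag t ω + α t • r t ω
  step_w : ∀ t, 1 ≤ t → ∀ ω, IsProx ip Z dgf gradDgf (fun u => γ t * J u) (r t ω)
    (γ t • Hs (r t ω) (ζ (2 * t - 1) ω) + γ t • Gs (wmd t ω) (ξ t ω)) (w (t + 1) ω)
  step_r : ∀ t, 1 ≤ t → ∀ ω, IsProx ip Z dgf gradDgf (fun u => γ t * J u) (r t ω)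
    (γ t • Hs (w (t + 1) ω) (ζ (2 * t) ω) + γ t • Gs (wmd t ω) (ξ t ω)) (r (t + 1) ω)
  step_wag : ∀ t, 1 ≤ t → ∀ ω, wag (t + 1) ω = (1 - α t) • wag t ω + α t • w (t + 1) ω

/-- `α_t = 2 / (t + 1)`. -/
noncomputable def ampAlpha (t : ℕ) : ℝ := 2 / ((t : ℝ) + 1)

/-- `γ_t = μ t / (4 L_G + 3 L_H t + σ (t + 1) √(μ t) / (√2 Ω_Z))` with
`σ = √(σ_H² + σ_G²)`. -/
noncomputable def ampGamma (μ LG LH σG σH ΩZ : ℝ) (t : ℕ) : ℝ :=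
  μ * t / (4 * LG + 3 * LH * t
    + Real.sqrt (σH ^ 2 + σG ^ 2) * ((t : ℝ) + 1) * Real.sqrt (μ * t) / (Real.sqrt 2 * ΩZ))

/-- The bound `𝒞₀(t)` on the expected gap. -/
noncomputable def ampC0 (μ LG LH σG σH ΩZ : ℝ) (t : ℕ) : ℝ :=
  16 * LG * ΩZ ^ 2 / (μ * t * ((t : ℝ) + 1)) + 12 * LH * ΩZ ^ 2 / (μ * ((t : ℝ) + 1))
    + 7 * (σG + σH) * ΩZ / Real.sqrt (μ * ((t : ℝ) - 1))

/-- The deviation coefficient `𝒞₁(t)`. -/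
noncomputable def ampC1 (μ σG σH ΩZ : ℝ) (t : ℕ) : ℝ :=
  6 * (σG + σH) * ΩZ / Real.sqrt (μ * ((t : ℝ) - 1))

/-! The proof combines the mirror-prox estimate with accelerated averaging, arranged so that each
noise term appears either squared or paired with a direction independent of the oracle call that
produced it.

One step (`amp_step`). Smoothness and convexity of `G`, convexity of `J` and monotonicity of `H`
bound `Q(w_{t+1}^{ag}, u) - (1 - α_t) Q(w_t^{ag}, u)` by the linearised gap at `w_{t+1}` plus a
multiple of `‖w_{t+1} - r_t‖²` (`viQ_average_le`). The prox steps bound the linearised gap and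
supply a negative multiple of the same square (`extragradient_step`); the stepsize makes the total
coefficient nonpositive.

Two dependences have to be broken. The noise of the second `H`-call would be paired with `r_{t+1}`,
which depends on that call; `r_{t+1}` is therefore compared with the prox step `p_t` taken with the
exact value `H(w_{t+1})`, at the cost of a squared noise (`IsProx.perturbed`). Moreover, the
supremum over `u` must be taken pathwise, so `u` may depend on all the noise; a mirror descent `v_t`
driven by the noise itself replaces `u` by `v_t` in the noise pairings, at the cost of squared
noises and one more Bregman distance (`aux_step`).

Multiplication by `t(t+1)/(2γ_t)` makes the gaps telescope. Since `t/γ_t` is nondecreasing and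
Bregman distances are at most `Ω_Z²`, the distances contribute only `2(t/γ_t)Ω_Z²`
(`viQ_recursion`). The resulting bound is free of `u`, hence bounds `g` pathwise
(`IsAuxiliary.viGap_le`).

For (a), the paired noise terms have mean zero and the squared ones mean at most `σ_G²` or `σ_H²`.
For (b), three sums of squares are controlled by Jensen and Markov for the exponential, two sums of
paired noises by a sub-Gaussian estimate, and a union bound gives `3 exp(-λ) + 2 exp(-λ²/3)`.
Independence from the past requires measurable iterates, which follows from a measurable
prox-mapping (`IsDistanceGenerating.exists_measurable_prox`). -/

/-! ### Prox-mappings and Bregman distances. -/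

section Prox

open Filter Topology

variable {E : Type*} [NormedAddCommGroup E] [NormedSpace ℝ E] {ip : E →L[ℝ] E →L[ℝ] ℝ}
  {Z : Set E} {μ : ℝ} {dgf : E → ℝ} {gradDgf : E → E}

/-- The directional derivative as the limit of difference quotients with increments
`1 / (n + 1)`. -/
lemma HasFDerivWithinAt.tendsto_difference_quotient {f : E → ℝ} {f' : E →L[ℝ] ℝ}
    (hZ : Convex ℝ Z) {z u : E} (hz : z ∈ Z) (hu : u ∈ Z) (h : HasFDerivWithinAt f f' Z z) :
    Tendsto (fun n : ℕ => ((n : ℝ) + 1) * (f (z + ((n : ℝ) + 1)⁻¹ • (u - z)) - f z)) atTop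
      (𝓝 (f' (u - z))) := by
  have hpos : ∀ n : ℕ, (0 : ℝ) < (n : ℝ) + 1 := fun n => by positivity
  refine h.lim (c := fun n : ℕ => (n : ℝ) + 1) (d := fun n : ℕ => ((n : ℝ) + 1)⁻¹ • (u - z))
    ?_ ?_ ?_
  · have := (tendsto_one_div_add_atTop_nhds_zero_nat (𝕜 := ℝ)).smul_const (u - z)
    simpa using this
  · refine Eventually.of_forall fun n => hZ.add_smul_sub_mem hz hu ⟨(inv_pos.2 (hpos n)).le, ?_⟩
    refine inv_le_one_of_one_le₀ ?_
    have : (0 : ℝ) ≤ n := n.cast_nonneg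
    linarith
  · refine tendsto_const_nhds.congr fun n => ?_
    rw [smul_smul, mul_inv_cancel₀ (hpos n).ne', one_smul]

lemma one_div_succ_mem (n : ℕ) : 0 < ((n : ℝ) + 1)⁻¹ ∧ ((n : ℝ) + 1)⁻¹ ≤ 1 := by
  have : (0 : ℝ) ≤ n := n.cast_nonneg
  exact ⟨by positivity, inv_le_one_of_one_le₀ (by linarith)⟩

/-- Strong convexity bounds the prox-function from below by the squared distance. -/
lemma IsDistanceGenerating.le_bregman (h : IsDistanceGenerating ip Z μ dgf gradDgf)
    {z u : E} (hz : z ∈ Z) (hu : u ∈ Z) :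
    μ / 2 * ‖u - z‖ ^ 2 ≤ bregman ip dgf gradDgf z u := by
  have hZ := h.strongConvex.1
  have hlim := HasFDerivWithinAt.tendsto_difference_quotient hZ hz hu (h.hasGradient z hz)
  -- Strong convexity at `z + s(u - z)`, divided by `s`, carries a factor `1 - s` that tends to `1`
  -- as `s → 0`.
  have hlim2 : Tendsto (fun n : ℕ => dgf u - dgf z
      - (1 - ((n : ℝ) + 1)⁻¹) * (μ / 2 * ‖u - z‖ ^ 2)) atTop
      (𝓝 (dgf u - dgf z - (1 - 0) * (μ / 2 * ‖u - z‖ ^ 2))) := by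
    have := tendsto_one_div_add_atTop_nhds_zero_nat (𝕜 := ℝ)
    simp only [one_div] at this
    exact ((this.const_sub 1).mul_const _).const_sub _
  have := le_of_tendsto_of_tendsto' hlim hlim2 fun n => by
    obtain ⟨h0, h1⟩ := one_div_succ_mem n
    set s := ((n : ℝ) + 1)⁻¹ with hs
    have hn : (n : ℝ) + 1 = s⁻¹ := by rw [hs, inv_inv]
    have key := h.strongConvex.2 hz hu (sub_nonneg.2 h1) h0.le (by ring : (1 - s) + s = 1)
    have e : (1 - s) • z + s • u = z + s • (u - z) := by
      rw [smul_sub, sub_smul, one_smul]; abel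
    rw [e, norm_sub_rev] at key
    simp only [smul_eq_mul] at key
    rw [hn, inv_mul_le_iff₀ h0]
    linarith
  unfold bregman
  linarith

lemma IsDistanceGenerating.bregman_nonneg (h : IsDistanceGenerating ip Z μ dgf gradDgf)
    {z u : E} (hz : z ∈ Z) (hu : u ∈ Z) : 0 ≤ bregman ip dgf gradDgf z u :=
  le_trans (by have := h.mu_pos; positivity) (h.le_bregman hz hu)

/-- The three-point inequality of the prox-mapping. -/
lemma IsProx.three_point (h : IsDistanceGenerating ip Z μ dgf gradDgf) {J : E → ℝ}
    (hJ : ConvexOn ℝ Z J) {z η w u : E} (hw : IsProx ip Z dgf gradDgf J z η w)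
    (hu : u ∈ Z) :
    ip η (w - u) + J w - J u + bregman ip dgf gradDgf z w + bregman ip dgf gradDgf w u
      ≤ bregman ip dgf gradDgf z u := by
  obtain ⟨hwZ, hmin⟩ := hw
  have hZ := h.strongConvex.1
  have hlim := HasFDerivWithinAt.tendsto_difference_quotient hZ hwZ hu (h.hasGradient w hwZ)
  -- First-order optimality of `w`: minimality against `w + s(u - w)`, divided by `s`, in the limit
  -- `s → 0`. For `J` convexity suffices, so no derivative of `J` appears.
  have := ge_of_tendsto' hlim (b := ip (gradDgf z) (u - w) - ip η (u - w) - (J u - J w))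
    fun n => by
      obtain ⟨h0, h1⟩ := one_div_succ_mem n
      set s := ((n : ℝ) + 1)⁻¹ with hs
      have hn : (n : ℝ) + 1 = s⁻¹ := by rw [hs, inv_inv]
      have hm := isMinOn_iff.1 hmin _ (hZ.add_smul_sub_mem hwZ hu ⟨h0.le, h1⟩)
      have key := hJ.2 hwZ hu (sub_nonneg.2 h1) h0.le (by ring : (1 - s) + s = 1)
      have e : (1 - s) • w + s • u = w + s • (u - w) := by
        rw [smul_sub, sub_smul, one_smul]; abel
      rw [e] at key
      simp only [smul_eq_mul] at key
      have e2 : w + s • (u - w) - z = (w - z) + s • (u - w) := by abel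
      simp only [bregman, e2, map_add, map_smul, smul_eq_mul] at hm
      rw [hn, le_inv_mul_iff₀ h0]
      linarith
  have e1 : ip η (w - u) = - ip η (u - w) := by rw [← neg_sub u w, map_neg]
  have e2 : ip (gradDgf z) (u - z) = ip (gradDgf z) (u - w) + ip (gradDgf z) (w - z) := by
    rw [← map_add, sub_add_sub_cancel]
  unfold bregman
  rw [e1, e2]
  linarith

lemma ip_le_dualNorm (ip : E →L[ℝ] E →L[ℝ] ℝ) (x y : E) : ip x y ≤ dualNorm ip x * ‖y‖ :=
  (le_abs_self _).trans ((ip x).le_opNorm y)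

lemma abs_ip_le_dualNorm (ip : E →L[ℝ] E →L[ℝ] ℝ) (x y : E) :
    |ip x y| ≤ dualNorm ip x * ‖y‖ :=
  (ip x).le_opNorm y

lemma dualNorm_nonneg (ip : E →L[ℝ] E →L[ℝ] ℝ) (x : E) : 0 ≤ dualNorm ip x := norm_nonneg _

/-- Young's inequality for the pairing of a vector with a displacement. -/
lemma mul_sub_sq_le {μ d y : ℝ} (hμ : 0 < μ) : d * y - μ / 2 * y ^ 2 ≤ d ^ 2 / (2 * μ) := by
  rw [le_div_iff₀ (by positivity)]
  nlinarith [sq_nonneg (d - μ * y)]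

/-- The effect of a perturbation of the linear term on the progress of a prox-step. -/
lemma IsProx.perturbed (h : IsDistanceGenerating ip Z μ dgf gradDgf) {J : E → ℝ}
    (hJ : ConvexOn ℝ Z J) {z ψ δ p q u : E} (hp : IsProx ip Z dgf gradDgf J z ψ p)
    (hq : IsProx ip Z dgf gradDgf J z (ψ + δ) q) (hu : u ∈ Z) :
    ip ψ (p - u) + J p - J u + bregman ip dgf gradDgf z p + bregman ip dgf gradDgf q u
      ≤ bregman ip dgf gradDgf z u + ip δ (u - p) + dualNorm ip δ ^ 2 / (2 * μ) := by
  -- The progress of `q` towards `u` is added to that of `p` towards `q`; the term `V(p, q)` gained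
  -- in the second absorbs `⟨δ, p - q⟩` by Young's inequality.
  have h1 := hq.three_point h hJ hu
  have h2 := hp.three_point h hJ hq.1
  have h3 := h.le_bregman hp.1 hq.1
  have h4 := ip_le_dualNorm ip δ (p - q)
  have h5 := mul_sub_sq_le (d := dualNorm ip δ) (y := ‖p - q‖) h.mu_pos
  rw [norm_sub_rev q p] at h3
  simp only [map_add, add_apply, map_sub] at h1 h2 h3 h4 ⊢
  linarith

end Prox

/-! ### The one-step estimate. -/

section Recursion

variable {E : Type*} [NormedAddCommGroup E] [NormedSpace ℝ E] {ip : E →L[ℝ] E →L[ℝ] ℝ}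
  {Z : Set E} {μ : ℝ} {dgf : E → ℝ} {gradDgf : E → E} {G : E → ℝ} {gradG H : E → E} {J : E → ℝ}
  {LG LH : ℝ}

lemma dualNorm_smul (ip : E →L[ℝ] E →L[ℝ] ℝ) (c : ℝ) (x : E) :
    dualNorm ip (c • x) = |c| * dualNorm ip x := by
  simp [dualNorm, norm_smul]

lemma dualNorm_add_le (ip : E →L[ℝ] E →L[ℝ] ℝ) (x y : E) :
    dualNorm ip (x + y) ≤ dualNorm ip x + dualNorm ip y := by
  simpa [dualNorm] using norm_add_le (ip x) (ip y)

lemma dualNorm_add_sq_le (ip : E →L[ℝ] E →L[ℝ] ℝ) (x y : E) :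
    dualNorm ip (x + y) ^ 2 ≤ 2 * dualNorm ip x ^ 2 + 2 * dualNorm ip y ^ 2 := by
  have h1 := pow_le_pow_left₀ (dualNorm_nonneg ip _) (dualNorm_add_le ip x y) 2
  nlinarith [sq_nonneg (dualNorm ip x - dualNorm ip y)]

/-- Progress of the extragradient pair `w`, `r'`, with `p` the second prox-step taken with the
exact value of the operator. -/
lemma extragradient_step (hVI : IsVIProblem ip Z G gradG H J LG LH)
    (hdgf : IsDistanceGenerating ip Z μ dgf gradDgf) {γ : ℝ} (hγ : 0 < γ)
    {r w r' p g a b u : E} (hr : r ∈ Z) (hu : u ∈ Z)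
    (hw : IsProx ip Z dgf gradDgf (fun u => γ * J u) r (γ • a + γ • g) w)
    (hr' : IsProx ip Z dgf gradDgf (fun u => γ * J u) r (γ • b + γ • g) r')
    (hp : IsProx ip Z dgf gradDgf (fun u => γ * J u) r (γ • H w + γ • g) p) :
    γ * (ip (H w + g) (w - u) + J w - J u) + bregman ip dgf gradDgf r' u
      ≤ bregman ip dgf gradDgf r u + γ * ip (b - H w) (u - p)
        + γ ^ 2 / μ * (dualNorm ip (b - H w) ^ 2 / 2 + 2 / 3 * dualNorm ip (a - H r) ^ 2)
        + (2 * γ ^ 2 * LH ^ 2 / μ - μ / 2) * ‖w - r‖ ^ 2 := by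
  have hμ := hdgf.mu_pos
  have hJ : ConvexOn ℝ Z (fun u => γ * J u) := by
    simpa [smul_eq_mul] using hVI.convexJ.smul hγ.le
  -- The step to `r'` is the step to `p` with its linear term perturbed by the noise `γ(b - H w)`.
  have e : γ • b + γ • g = (γ • H w + γ • g) + γ • (b - H w) := by
    rw [smul_sub]; abel
  rw [e] at hr'
  have h1 := hp.perturbed hdgf hJ hr' hu
  have h2 := hw.three_point hdgf hJ hp.1
  have h3 := hdgf.le_bregman hr hw.1
  have h4 := hdgf.le_bregman hw.1 hp.1
  rw [norm_sub_rev] at h4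
  have h5 : ip (H w - a) (w - p) ≤ (LH * ‖w - r‖ + dualNorm ip (a - H r)) * ‖w - p‖ := by
    refine (ip_le_dualNorm ip _ _).trans (mul_le_mul_of_nonneg_right ?_ (norm_nonneg _))
    have e1 : H w - a = (H w - H r) + (-1 : ℝ) • (a - H r) := by
      rw [neg_one_smul]; abel
    rw [e1]
    refine (dualNorm_add_le ip _ _).trans ?_
    rw [dualNorm_smul]
    have := hVI.lipschitz w hw.1 r hr
    simpa using this
  set d1 := dualNorm ip (a - H r) with hd1
  set d2 := dualNorm ip (b - H w) with hd2
  -- `V(w, p)` absorbs the mismatch between `H w` and `a`. The square is then split by `(x + y)² ≤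
  -- 4x² + (4/3)y²`, which gives `2/3` for the noise of `a` and `2` for the Lipschitz term.
  have h6 := mul_sub_sq_le (d := γ * (LH * ‖w - r‖ + d1)) (y := ‖w - p‖) hμ
  have h7 : (γ * (LH * ‖w - r‖ + d1)) ^ 2 / (2 * μ)
      ≤ γ ^ 2 / μ * (2 / 3 * d1 ^ 2) + (2 * γ ^ 2 * LH ^ 2 / μ) * ‖w - r‖ ^ 2 := by
    have : (LH * ‖w - r‖ + d1) ^ 2 ≤ 4 * (LH * ‖w - r‖) ^ 2 + 4 / 3 * d1 ^ 2 := by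
      nlinarith [sq_nonneg (3 * (LH * ‖w - r‖) - d1)]
    have h8 := mul_le_mul_of_nonneg_left this (by positivity : 0 ≤ γ ^ 2 / (2 * μ))
    calc _ = γ ^ 2 / (2 * μ) * (LH * ‖w - r‖ + d1) ^ 2 := by ring
      _ ≤ _ := h8
      _ = _ := by field_simp; ring
  have h9 : dualNorm ip (γ • (b - H w)) ^ 2 / (2 * μ) = γ ^ 2 / μ * (d2 ^ 2 / 2) := by
    rw [dualNorm_smul, mul_pow, sq_abs]; field_simp; rfl
  rw [h9] at h1
  have h10 := mul_le_mul_of_nonneg_left h5 hγ.le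
  simp only [map_add, map_smul, add_apply, smul_apply,
    smul_eq_mul, map_sub, sub_apply] at h1 h2 h10 ⊢
  linarith

/-- The mirror descent step on the negative noise. -/
lemma aux_step (hdgf : IsDistanceGenerating ip Z μ dgf gradDgf) {γ : ℝ} {v v' D N u : E}
    (hv : v ∈ Z) (hu : u ∈ Z)
    (hv' : IsProx ip Z dgf gradDgf (fun _ => 0) v ((-γ) • (D + N)) v') :
    bregman ip dgf gradDgf v' u ≤ bregman ip dgf gradDgf v u
      + γ * ip D (v - u) + γ * ip N (v - u)
      + γ ^ 2 / μ * (dualNorm ip D ^ 2 + dualNorm ip N ^ 2) := by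
  have hμ := hdgf.mu_pos
  -- `v` is its own prox point for the zero functional, so the noise acts as a perturbation of a
  -- step that does not move.
  have hvv : IsProx ip Z dgf gradDgf (fun _ => 0) v 0 v := by
    refine ⟨hv, isMinOn_iff.2 fun x hx => ?_⟩
    have := hdgf.bregman_nonneg hv hx
    simpa [bregman] using this
  have s2 := hvv.perturbed (δ := (-γ) • (D + N)) hdgf
    (convexOn_const 0 hdgf.strongConvex.1) (by rwa [zero_add]) hu
  have k : dualNorm ip ((-γ) • (D + N)) ^ 2 / (2 * μ)
      ≤ γ ^ 2 / μ * (dualNorm ip D ^ 2 + dualNorm ip N ^ 2) := by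
    rw [dualNorm_smul, mul_pow, sq_abs, neg_sq]
    calc _ ≤ γ ^ 2 * (2 * dualNorm ip D ^ 2 + 2 * dualNorm ip N ^ 2) / (2 * μ) := by
          gcongr; exact dualNorm_add_sq_le ip D N
      _ = _ := by field_simp
  have k2 := hdgf.bregman_nonneg hv hv
  have k3 : ip ((-γ) • (D + N)) (u - v) = γ * ip D (v - u) + γ * ip N (v - u) := by
    simp only [map_smul, smul_apply, smul_eq_mul, map_add, add_apply, map_sub]; ring
  simp only [map_zero, zero_apply] at s2
  linarith

/-- Progress of the gap function under averaging. -/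
lemma viQ_average_le (hVI : IsVIProblem ip Z G gradG H J LG LH) {α : ℝ} (hα0 : 0 ≤ α)
    (hα1 : α ≤ 1) {r w wag wag' md u : E} (hr : r ∈ Z) (hw : w ∈ Z) (hwagZ : wag ∈ Z)
    (hu : u ∈ Z) (hmd : md = (1 - α) • wag + α • r) (hwag : wag' = (1 - α) • wag + α • w) :
    viQ ip G H J wag' u - (1 - α) * viQ ip G H J wag u
      ≤ α * (ip (H w + gradG md) (w - u) + J w - J u) + LG / 2 * (α * ‖w - r‖) ^ 2 := by
  have hα1' := sub_nonneg.2 hα1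
  have hmdZ : md ∈ Z := hmd ▸ hVI.convex hwagZ hr hα1' hα0 (by ring)
  have hwag'Z : wag' ∈ Z := hwag ▸ hVI.convex hwagZ hw hα1' hα0 (by ring)
  have g1 := hVI.bregman_le wag' hwag'Z md hmdZ
  have g2 := hVI.bregman_nonneg wag hwagZ md hmdZ
  have g3 := hVI.bregman_nonneg u hu md hmdZ
  -- The two averages differ only in their `α`-part, so the smoothness error carries `α²`: this is
  -- the source of acceleration.
  have g4 : wag' - md = α • (w - r) := by rw [hwag, hmd, smul_sub]; abel
  have g5 : ip (gradG md) (wag' - md)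
      = (1 - α) * ip (gradG md) (wag - md) + α * ip (gradG md) (w - md) := by
    have : wag' - md = (1 - α) • (wag - md) + α • (w - md) := by rw [hwag]; module
    rw [this]; simp
  rw [g5, g4, norm_smul, Real.norm_of_nonneg hα0] at g1
  have g6 : G wag' ≤ (1 - α) * G wag + α * (G u + ip (gradG md) (w - u))
      + LG / 2 * (α * ‖w - r‖) ^ 2 := by
    have k1 := mul_nonneg hα1' g2
    have k2 := mul_nonneg hα0 g3
    have k3 : ip (gradG md) (w - u) = ip (gradG md) (w - md) - ip (gradG md) (u - md) := by
      rw [← map_sub, sub_sub_sub_cancel_right]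
    rw [k3]
    linarith
  have g7 : J wag' ≤ (1 - α) * J wag + α * J w := by
    have := hVI.convexJ.2 hwagZ hw hα1' hα0 (by ring)
    rw [hwag]; simpa using this
  have g9 : ip (H u) (wag' - u) = (1 - α) * ip (H u) (wag - u) + α * ip (H u) (w - u) := by
    have : wag' - u = (1 - α) • (wag - u) + α • (w - u) := by rw [hwag]; module
    rw [this]; simp
  -- Monotonicity trades `H u`, which occurs in `Q`, for `H w`, which the algorithm queries.
  have k := mul_nonneg hα0 (hVI.monotone w hw u hu)
  unfold viQ
  rw [g9]
  simp only [map_add, add_apply, map_sub, sub_apply] at k g6 ⊢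
  linarith

/-- One step of the stochastic accelerated mirror-prox method; `v`, `v'` are consecutive points
of the auxiliary mirror descent on the noise. -/
lemma amp_step (hVI : IsVIProblem ip Z G gradG H J LG LH)
    (hdgf : IsDistanceGenerating ip Z μ dgf gradDgf) {α γ : ℝ} (hα0 : 0 ≤ α) (hα1 : α ≤ 1)
    (hγ : 0 < γ) (hq : 4 * LH ^ 2 * γ ^ 2 + LG * α * γ * μ ≤ μ ^ 2 / 2)
    {r w r' p v v' wag wag' md g a b u : E} (hr : r ∈ Z) (hv : v ∈ Z) (hwagZ : wag ∈ Z)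
    (hu : u ∈ Z) (hmd : md = (1 - α) • wag + α • r) (hwag : wag' = (1 - α) • wag + α • w)
    (hw : IsProx ip Z dgf gradDgf (fun u => γ * J u) r (γ • a + γ • g) w)
    (hr' : IsProx ip Z dgf gradDgf (fun u => γ * J u) r (γ • b + γ • g) r')
    (hp : IsProx ip Z dgf gradDgf (fun u => γ * J u) r (γ • H w + γ • g) p)
    (hv' : IsProx ip Z dgf gradDgf (fun _ => 0) v ((-γ) • ((b - H w) + (g - gradG md))) v') :
    γ * (viQ ip G H J wag' u - (1 - α) * viQ ip G H J wag u)
        + α * (bregman ip dgf gradDgf r' u + bregman ip dgf gradDgf v' u)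
      ≤ α * (bregman ip dgf gradDgf r u + bregman ip dgf gradDgf v u
        + γ ^ 2 / μ * (2 / 3 * dualNorm ip (a - H r) ^ 2 + 3 / 2 * dualNorm ip (b - H w) ^ 2
          + 2 * dualNorm ip (g - gradG md) ^ 2)
        + γ * ip (g - gradG md) (v - r) + γ * ip (b - H w) (v - p)) := by
  have hμ := hdgf.mu_pos
  have s1 := extragradient_step hVI hdgf hγ hr hu hw hr' hp
  have q1 := viQ_average_le hVI hα0 hα1 hr hw.1 hwagZ hu hmd hwag
  have s4 := aux_step hdgf hv hu hv'
  set D := b - H w with hD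
  set N := g - gradG md with hN
  -- the noise of the gradient oracle in the direction `w - r`
  have n1 := ip_le_dualNorm ip N (r - w)
  rw [norm_sub_rev] at n1
  have n2 : γ * dualNorm ip N * ‖w - r‖ - μ / 4 * ‖w - r‖ ^ 2
      ≤ γ ^ 2 / μ * dualNorm ip N ^ 2 := by
    have := mul_sub_sq_le (d := γ * dualNorm ip N) (y := ‖w - r‖) (half_pos hμ)
    calc _ = γ * dualNorm ip N * ‖w - r‖ - μ / 2 / 2 * ‖w - r‖ ^ 2 := by ring
      _ ≤ _ := this
      _ = _ := by field_simp
  -- The prox steps supply `-μ/2`, of which `μ/4` has just been spent on the gradient noise; the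
  -- hypothesis `hq` states that the rest covers the Lipschitz and smoothness terms.
  have n3 : (2 * γ ^ 2 * LH ^ 2 / μ + LG * α * γ / 2 - μ / 4) * ‖w - r‖ ^ 2 ≤ 0 := by
    refine mul_nonpos_of_nonpos_of_nonneg ?_ (sq_nonneg _)
    have : 2 * γ ^ 2 * LH ^ 2 / μ + LG * α * γ / 2 - μ / 4
        = (4 * LH ^ 2 * γ ^ 2 + LG * α * γ * μ - μ ^ 2 / 2) / (2 * μ) := by
      field_simp; ring
    rw [this]
    exact div_nonpos_of_nonpos_of_nonneg (by linarith) (by positivity)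
  -- The direction `u - w` splits as `(u - v) + (v - r) + (r - w)`: the first part is cancelled by
  -- the auxiliary descent, the second is fixed before the oracle call and is kept, the third has
  -- been absorbed above.
  have e1 : ip (H w + gradG md) (w - u) = ip (H w + g) (w - u) + ip N (u - w) := by
    have : g = gradG md + N := by rw [hN]; abel
    rw [this]; simp only [map_add, add_apply, map_sub]; ring
  have fin : γ * (ip (H w + gradG md) (w - u) + J w - J u) + LG * α * γ / 2 * ‖w - r‖ ^ 2
      + bregman ip dgf gradDgf r' u + bregman ip dgf gradDgf v' u
      ≤ bregman ip dgf gradDgf r u + bregman ip dgf gradDgf v u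
        + γ ^ 2 / μ * (2 / 3 * dualNorm ip (a - H r) ^ 2 + 3 / 2 * dualNorm ip D ^ 2
          + 2 * dualNorm ip N ^ 2)
        + γ * ip N (v - r) + γ * ip D (v - p) := by
    have n1' := mul_le_mul_of_nonneg_left n1 hγ.le
    rw [e1]
    simp only [map_sub] at s1 s4 n1' ⊢
    linarith
  have f1 := mul_le_mul_of_nonneg_left fin hα0
  have f2 := mul_le_mul_of_nonneg_left q1 hγ.le
  linarith

end Recursion

/-! ### Stepsizes and numerical estimates. -/

section StepSize

variable {μ LG LH σG σH ΩZ : ℝ}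

/-- The denominator of the stepsize `ampGamma`. -/
noncomputable def ampDenom (μ LG LH σG σH ΩZ : ℝ) (t : ℕ) : ℝ :=
  4 * LG + 3 * LH * t
    + Real.sqrt (σH ^ 2 + σG ^ 2) * ((t : ℝ) + 1) * Real.sqrt (μ * t) / (Real.sqrt 2 * ΩZ)

lemma ampDenom_mono (hμ : 0 < μ) (hLH : 0 ≤ LH) (hΩ : 0 < ΩZ) :
    Monotone (ampDenom μ LG LH σG σH ΩZ) := by
  intro s t hst
  unfold ampDenom
  have : (s : ℝ) ≤ t := by exact_mod_cast hst
  gcongr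

lemma le_ampDenom (hΩ : 0 < ΩZ) (t : ℕ) :
    4 * LG + 3 * LH * t ≤ ampDenom μ LG LH σG σH ΩZ t := by
  unfold ampDenom
  have : 0 ≤ Real.sqrt (σH ^ 2 + σG ^ 2) * ((t : ℝ) + 1) * Real.sqrt (μ * t)
    / (Real.sqrt 2 * ΩZ) := by positivity
  linarith

lemma ampDenom_pos (hμ : 0 < μ) (hLG : 0 ≤ LG) (hLH : 0 ≤ LH) (hσG : 0 ≤ σG) (hσH : 0 ≤ σH)
    (hΩ : 0 < ΩZ) (hpos : 0 < LG + LH + σG + σH) {t : ℕ} (ht : 1 ≤ t) :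
    0 < ampDenom μ LG LH σG σH ΩZ t := by
  have ht0 : (0 : ℝ) < t := by exact_mod_cast ht
  unfold ampDenom
  rcases (by positivity : 0 ≤ σH ^ 2 + σG ^ 2).eq_or_lt with h | h
  · have h1 : σH = 0 := by nlinarith
    have h2 : σG = 0 := by nlinarith
    subst h1 h2
    have : 0 < 4 * LG + 3 * LH * t := by
      rcases hLG.eq_or_lt with h | h
      · subst h
        have : 0 < LH := by linarith
        positivity
      · positivity
    simpa using this
  · have : 0 < Real.sqrt (σH ^ 2 + σG ^ 2) * ((t : ℝ) + 1) * Real.sqrt (μ * t)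
      / (Real.sqrt 2 * ΩZ) := by positivity
    positivity

lemma ampGamma_eq (t : ℕ) :
    ampGamma μ LG LH σG σH ΩZ t = μ * t / ampDenom μ LG LH σG σH ΩZ t := rfl

lemma ampGamma_pos (hμ : 0 < μ) (hLG : 0 ≤ LG) (hLH : 0 ≤ LH) (hσG : 0 ≤ σG) (hσH : 0 ≤ σH)
    (hΩ : 0 < ΩZ) (hpos : 0 < LG + LH + σG + σH) {t : ℕ} (ht : 1 ≤ t) :
    0 < ampGamma μ LG LH σG σH ΩZ t := by
  have ht0 : (0 : ℝ) < t := by exact_mod_cast ht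
  rw [ampGamma_eq]
  exact div_pos (by positivity) (ampDenom_pos hμ hLG hLH hσG hσH hΩ hpos ht)

lemma div_ampGamma {t : ℕ} (ht : 1 ≤ t) :
    t / ampGamma μ LG LH σG σH ΩZ t = ampDenom μ LG LH σG σH ΩZ t / μ := by
  have ht0 : (t : ℝ) ≠ 0 := by positivity
  rw [ampGamma_eq, div_div_eq_mul_div, mul_comm μ, mul_div_mul_left _ _ ht0]

/-- The quotient is the denominator of the stepsize divided by `μ`, which grows with `t`. This is
what allows the Bregman distances to telescope; the case `t = 0` serves the start of the induction.
-/
lemma div_ampGamma_le_succ (hμ : 0 < μ) (hLG : 0 ≤ LG) (hLH : 0 ≤ LH) (hσG : 0 ≤ σG)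
    (hσH : 0 ≤ σH) (hΩ : 0 < ΩZ) (hpos : 0 < LG + LH + σG + σH) (t : ℕ) :
    t / ampGamma μ LG LH σG σH ΩZ t
      ≤ (t + 1 : ℕ) / ampGamma μ LG LH σG σH ΩZ (t + 1) := by
  rcases Nat.eq_zero_or_pos t with rfl | ht
  · have := ampGamma_pos hμ hLG hLH hσG hσH hΩ hpos (le_refl 1)
    simp [this.le]
  · rw [div_ampGamma ht, div_ampGamma (Nat.le_add_left 1 t)]
    have := ampDenom_mono (LG := LG) (σG := σG) (σH := σH) hμ hLH hΩ (Nat.le_succ t)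
    gcongr

/-- The stepsizes are small compared with the smoothness constants. -/
lemma ampGamma_small (hμ : 0 < μ) (hLG : 0 ≤ LG) (hLH : 0 ≤ LH) (hσG : 0 ≤ σG)
    (hσH : 0 ≤ σH) (hΩ : 0 < ΩZ) (hpos : 0 < LG + LH + σG + σH) {t : ℕ} (ht : 1 ≤ t) :
    4 * LH ^ 2 * ampGamma μ LG LH σG σH ΩZ t ^ 2
      + LG * ampAlpha t * ampGamma μ LG LH σG σH ΩZ t * μ ≤ μ ^ 2 / 2 := by
  have hd := ampDenom_pos hμ hLG hLH hσG hσH hΩ hpos ht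
  have hle := le_ampDenom (μ := μ) (LG := LG) (LH := LH) (σG := σG) (σH := σH) hΩ t
  rw [ampGamma_eq]
  set d := ampDenom μ LG LH σG σH ΩZ t
  have ht0 : (0 : ℝ) < t := by exact_mod_cast ht
  have hX : 0 ≤ LH * t / d := by positivity
  have hY : 0 ≤ LG / d := by positivity
  have hXY : 4 * (LG / d) + 3 * (LH * t / d) ≤ 1 := by
    have : 4 * (LG / d) + 3 * (LH * t / d) = (4 * LG + 3 * LH * t) / d := by ring
    rw [this]
    exact (div_le_one hd).2 hle
  have hα : ampAlpha t * t ≤ 2 := by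
    unfold ampAlpha
    rw [div_mul_eq_mul_div, div_le_iff₀ (by positivity)]
    linarith
  have e : 4 * LH ^ 2 * (μ * t / d) ^ 2 + LG * ampAlpha t * (μ * t / d) * μ
      = μ ^ 2 * (4 * (LH * t / d) ^ 2 + LG / d * (ampAlpha t * t)) := by ring
  rw [e]
  -- With `X = LH t / d` and `Y = LG / d`, `4Y + 3X ≤ 1` gives `4X² + 2Y ≤ 4X² + (1 - 3X)/2`, at
  -- most `1/2` because `X ≤ 1/3 < 3/8`.
  have : 4 * (LH * t / d) ^ 2 + LG / d * (ampAlpha t * t) ≤ 1 / 2 := by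
    nlinarith [mul_le_mul_of_nonneg_left hα hY]
  nlinarith [sq_nonneg μ]

lemma ampAlpha_mem {t : ℕ} (ht : 1 ≤ t) : 0 ≤ ampAlpha t ∧ ampAlpha t ≤ 1 := by
  have ht0 : (1 : ℝ) ≤ t := by exact_mod_cast ht
  unfold ampAlpha
  exact ⟨by positivity, (div_le_one (by positivity)).2 (by linarith)⟩

/-- The noise contribution to the stepsize bound. -/
lemma mul_ampGamma_div_mul_le (hμ : 0 < μ) (hLG : 0 ≤ LG) (hLH : 0 ≤ LH) (hΩ : 0 < ΩZ)
    {i : ℕ} (hi : 1 ≤ i) :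
    i * ampGamma μ LG LH σG σH ΩZ i / μ * (σH ^ 2 + σG ^ 2)
      ≤ Real.sqrt 2 * (ΩZ / Real.sqrt μ) * Real.sqrt (σH ^ 2 + σG ^ 2)
        * (i * Real.sqrt i / (i + 1)) := by
  have hi0 : (0 : ℝ) < i := by exact_mod_cast hi
  have hs : 0 ≤ σH ^ 2 + σG ^ 2 := by positivity
  rcases hs.eq_or_lt with h | h
  · simp [← h]
  have hσ := Real.sqrt_pos.2 h
  have hσ2 := Real.sq_sqrt hs
  rw [ampGamma_eq]
  -- Only the noise part of the denominator is kept.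
  have hd : Real.sqrt (σH ^ 2 + σG ^ 2) * ((i : ℝ) + 1) * Real.sqrt (μ * i)
      / (Real.sqrt 2 * ΩZ) ≤ ampDenom μ LG LH σG σH ΩZ i := by
    unfold ampDenom
    have : 0 ≤ 4 * LG + 3 * LH * i := by positivity
    linarith
  set s := Real.sqrt (σH ^ 2 + σG ^ 2)
  have hd0 : 0 < s * ((i : ℝ) + 1) * Real.sqrt (μ * i) / (Real.sqrt 2 * ΩZ) := by positivity
  have hsi := Real.sq_sqrt hi0.le
  have hsi0 := Real.sqrt_pos.2 hi0
  have hsm0 := Real.sqrt_pos.2 hμ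
  calc _ ≤ i * (μ * i / (s * ((i : ℝ) + 1) * Real.sqrt (μ * i) / (Real.sqrt 2 * ΩZ))) / μ
        * (σH ^ 2 + σG ^ 2) := by gcongr
    _ = _ := by
      rw [← hσ2, Real.sqrt_mul hμ.le]
      field_simp
      rw [hsi]

/-- The increment of `(2/3) x^{3/2}` over `[n, n + 1]` is the integral of the concave function `√x`,
hence at least its trapezoidal value `(√n + √(n+1))/2`; this in turn dominates the new summand. Both
comparisons are carried out algebraically below, with `a = √n`, `b = √(n+1)` and `b² - a² = 1`. -/
lemma sum_mul_sqrt_div_le (t : ℕ) :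
    ∑ i ∈ Finset.Icc 1 t, ((i : ℝ) * Real.sqrt i / (i + 1)) ≤ 2 / 3 * (t * Real.sqrt t) := by
  induction t with
  | zero => simp
  | succ n ih =>
    rw [Finset.sum_Icc_succ_top (by omega)]
    refine (add_le_add_left ih _).trans ?_
    push_cast
    set a := Real.sqrt n
    set b := Real.sqrt ((n : ℝ) + 1)
    have ha : 0 ≤ a := Real.sqrt_nonneg _
    have hb : 0 < b := Real.sqrt_pos.2 (by positivity)
    have ha2 : a ^ 2 = n := Real.sq_sqrt (by positivity)
    have hb2 : b ^ 2 = n + 1 := Real.sq_sqrt (by positivity)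
    have hn : (n : ℝ) = b ^ 2 - 1 := by linarith
    have hb1 : 1 ≤ b := by nlinarith [(Nat.cast_nonneg n : (0 : ℝ) ≤ n)]
    have hab : a ≤ b := by nlinarith
    have h1 : ((n : ℝ) + 1) * b / (n + 1 + 1) ≤ b - 1 / (2 * b) := by
      rw [hn, div_le_iff₀ (by nlinarith)]
      have : (b - 1 / (2 * b)) * (b ^ 2 - 1 + 1 + 1) - (b ^ 2 - 1 + 1) * b
          = (b ^ 2 - 1) / (2 * b) := by field_simp; ring
      have : 0 ≤ (b ^ 2 - 1) / (2 * b) := div_nonneg (by nlinarith) (by positivity)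
      linarith
    have h2 : b - 1 / (2 * b) ≤ (a + b) / 2 := by
      have : 1 / (2 * b) ≥ (b - a) / 2 := by
        rw [ge_iff_le, le_div_iff₀ (by positivity)]
        nlinarith
      linarith
    have h3 : 2 / 3 * (((n : ℝ) + 1) * b) - 2 / 3 * (n * a) ≥ (a + b) / 2 := by
      rw [← hb2, ← ha2]
      have hd : b ^ 2 - a ^ 2 = 1 := by linarith
      have : 2 / 3 * (b ^ 2 * b) - 2 / 3 * (a ^ 2 * a) - (a + b) / 2
          = (b - a) * (2 / 3 * (b ^ 2 + a * b + a ^ 2) - (a + b) ^ 2 / 2) := by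
        have : (a + b) / 2 = (b ^ 2 - a ^ 2) * ((a + b) / 2) := by rw [hd, one_mul]
        rw [this]; ring
      have h4 : 0 ≤ (b - a) * (2 / 3 * (b ^ 2 + a * b + a ^ 2) - (a + b) ^ 2 / 2) :=
        mul_nonneg (by linarith) (by nlinarith [sq_nonneg (a - b)])
      linarith
    linarith

/-- The weighted sum of the squared noise levels. -/
lemma sum_ampGamma_le (hμ : 0 < μ) (hLG : 0 ≤ LG) (hLH : 0 ≤ LH) (hΩ : 0 < ΩZ) {t : ℕ}
    (ht : 2 ≤ t) :
    2 / (t * ((t : ℝ) + 1)) * ∑ i ∈ Finset.Icc 1 t,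
        (i * ampGamma μ LG LH σG σH ΩZ i / μ * (σH ^ 2 + σG ^ 2))
      ≤ 4 * Real.sqrt 2 / 3 * (Real.sqrt (σH ^ 2 + σG ^ 2) * ΩZ / Real.sqrt (μ * (t - 1))) := by
  have ht0 : (2 : ℝ) ≤ t := by exact_mod_cast ht
  have h1 : ∑ i ∈ Finset.Icc 1 t, (i * ampGamma μ LG LH σG σH ΩZ i / μ * (σH ^ 2 + σG ^ 2))
      ≤ Real.sqrt 2 * (ΩZ / Real.sqrt μ) * Real.sqrt (σH ^ 2 + σG ^ 2)
        * (2 / 3 * (t * Real.sqrt t)) := by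
    refine (Finset.sum_le_sum fun i hi =>
      mul_ampGamma_div_mul_le hμ hLG hLH hΩ (Finset.mem_Icc.1 hi).1).trans ?_
    rw [← Finset.mul_sum]
    gcongr
    exact sum_mul_sqrt_div_le t
  -- After squaring this is `t(t - 1) ≤ (t + 1)²`.
  have h2 : Real.sqrt t / (t + 1) ≤ 1 / Real.sqrt (t - 1) := by
    have hp : (0 : ℝ) < t - 1 := by linarith
    rw [div_le_div_iff₀ (by positivity) (Real.sqrt_pos.2 hp), one_mul, ← Real.sqrt_mul (by linarith)]
    refine Real.sqrt_le_iff.2 ⟨by linarith, ?_⟩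
    nlinarith
  calc _ ≤ 2 / (t * ((t : ℝ) + 1)) * (Real.sqrt 2 * (ΩZ / Real.sqrt μ)
        * Real.sqrt (σH ^ 2 + σG ^ 2) * (2 / 3 * (t * Real.sqrt t))) := by gcongr
    _ = 4 * Real.sqrt 2 / 3 * (ΩZ / Real.sqrt μ) * Real.sqrt (σH ^ 2 + σG ^ 2)
        * (Real.sqrt t / (t + 1)) := by
      have : (t : ℝ) ≠ 0 := by positivity
      field_simp; ring
    _ ≤ 4 * Real.sqrt 2 / 3 * (ΩZ / Real.sqrt μ) * Real.sqrt (σH ^ 2 + σG ^ 2)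
        * (1 / Real.sqrt (t - 1)) := by gcongr
    _ = _ := by
      rw [Real.sqrt_mul hμ.le]
      field_simp

/-- The deterministic part of the bound. -/
lemma div_ampGamma_mul_le (hμ : 0 < μ) (hΩ : 0 < ΩZ) {t : ℕ} (ht : 2 ≤ t) :
    2 / (t * ((t : ℝ) + 1)) * (2 * (t / ampGamma μ LG LH σG σH ΩZ t) * ΩZ ^ 2)
      ≤ 16 * LG * ΩZ ^ 2 / (μ * t * ((t : ℝ) + 1)) + 12 * LH * ΩZ ^ 2 / (μ * ((t : ℝ) + 1))
        + 2 * Real.sqrt 2 * (Real.sqrt (σH ^ 2 + σG ^ 2) * ΩZ / Real.sqrt (μ * (t - 1))) := by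
  have ht0 : (2 : ℝ) ≤ t := by exact_mod_cast ht
  have htp : (0 : ℝ) < t := by linarith
  rw [div_ampGamma (by omega)]
  unfold ampDenom
  set s := Real.sqrt (σH ^ 2 + σG ^ 2)
  have hm : 0 < Real.sqrt (μ * t) := Real.sqrt_pos.2 (by positivity)
  have hm1 : 0 < Real.sqrt (μ * (t - 1)) :=
    Real.sqrt_pos.2 (mul_pos hμ (by linarith))
  have e : 2 / (t * ((t : ℝ) + 1)) * (2 * ((4 * LG + 3 * LH * t + s * ((t : ℝ) + 1)
      * Real.sqrt (μ * t) / (Real.sqrt 2 * ΩZ)) / μ) * ΩZ ^ 2)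
      = 16 * LG * ΩZ ^ 2 / (μ * t * ((t : ℝ) + 1)) + 12 * LH * ΩZ ^ 2 / (μ * ((t : ℝ) + 1))
        + 2 * Real.sqrt 2 * (s * ΩZ / Real.sqrt (μ * t)) := by
    have h2 := Real.sq_sqrt (zero_le_two (α := ℝ))
    have h3 := Real.sq_sqrt (by positivity : 0 ≤ μ * t)
    have h20 : 0 < Real.sqrt 2 := by positivity
    have : s * ((t : ℝ) + 1) * Real.sqrt (μ * t) / (Real.sqrt 2 * ΩZ)
        = μ * t * ((t : ℝ) + 1) * Real.sqrt 2 * s / (2 * ΩZ * Real.sqrt (μ * t)) := by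
      rw [div_eq_div_iff (by positivity) (by positivity)]
      linear_combination 2 * s * (t + 1) * ΩZ * h3 - μ * t * (t + 1) * s * ΩZ * h2
    rw [this]
    field_simp
    ring
  rw [e]
  have : Real.sqrt (μ * (t - 1)) ≤ Real.sqrt (μ * t) :=
    Real.sqrt_le_sqrt (by nlinarith)
  gcongr

lemma sqrt_add_sq_le (hσG : 0 ≤ σG) (hσH : 0 ≤ σH) :
    Real.sqrt (σH ^ 2 + σG ^ 2) ≤ σG + σH :=
  Real.sqrt_le_iff.2 ⟨by positivity, by nlinarith⟩

lemma sqrt_two_le : Real.sqrt 2 ≤ 1.4143 :=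
  Real.sqrt_le_iff.2 ⟨by norm_num, by norm_num⟩

end StepSize

/-! ### Telescoping the one-step estimate. -/

section Telescoping

variable {E : Type*} [NormedAddCommGroup E] [NormedSpace ℝ E] {ip : E →L[ℝ] E →L[ℝ] ℝ}
  {Z : Set E} {μ : ℝ} {dgf : E → ℝ} {gradDgf : E → E} {G : E → ℝ} {gradG H : E → E} {J : E → ℝ}
  {LG LH σG σH ΩZ : ℝ}

/-- The weight `t(t+1)/2` is dictated by `α_t = 2/(t+1)`, since `t(t+1)/2 · (1 - α_t) = (t-1)t/2` is
the preceding weight. Keeping the current Bregman distances on the left makes the induction close.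
-/
lemma viQ_recursion (hVI : IsVIProblem ip Z G gradG H J LG LH)
    (hdgf : IsDistanceGenerating ip Z μ dgf gradDgf) (hΩ : 0 < ΩZ)
    (hV : ∀ z₁ ∈ Z, ∀ z₂ ∈ Z, bregman ip dgf gradDgf z₁ z₂ ≤ ΩZ ^ 2)
    (hσG : 0 ≤ σG) (hσH : 0 ≤ σH) (hpos : 0 < LG + LH + σG + σH)
    {γ : ℕ → ℝ} (hγ : γ = ampGamma μ LG LH σG σH ΩZ)
    {r w p v wag md g a b : ℕ → E} (hr : ∀ t, 1 ≤ t → r t ∈ Z) (hv : ∀ t, 1 ≤ t → v t ∈ Z)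
    (hwagZ : ∀ t, 1 ≤ t → wag t ∈ Z)
    (hmd : ∀ t, 1 ≤ t → md t = (1 - ampAlpha t) • wag t + ampAlpha t • r t)
    (hwag : ∀ t, 1 ≤ t → wag (t + 1) = (1 - ampAlpha t) • wag t + ampAlpha t • w (t + 1))
    (hw : ∀ t, 1 ≤ t → IsProx ip Z dgf gradDgf (fun u => γ t * J u) (r t)
      (γ t • a t + γ t • g t) (w (t + 1)))
    (hr' : ∀ t, 1 ≤ t → IsProx ip Z dgf gradDgf (fun u => γ t * J u) (r t)
      (γ t • b t + γ t • g t) (r (t + 1)))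
    (hp : ∀ t, 1 ≤ t → IsProx ip Z dgf gradDgf (fun u => γ t * J u) (r t)
      (γ t • H (w (t + 1)) + γ t • g t) (p t))
    (hv' : ∀ t, 1 ≤ t → IsProx ip Z dgf gradDgf (fun _ => 0) (v t)
      ((-γ t) • ((b t - H (w (t + 1))) + (g t - gradG (md t)))) (v (t + 1)))
    {u : E} (hu : u ∈ Z) (t : ℕ) :
    t * ((t : ℝ) + 1) / 2 * viQ ip G H J (wag (t + 1)) u
        + t / γ t * (bregman ip dgf gradDgf (r (t + 1)) u + bregman ip dgf gradDgf (v (t + 1)) u)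
      ≤ 2 * (t / γ t) * ΩZ ^ 2 + ∑ i ∈ Finset.Icc 1 t,
        (i * γ i / μ * (2 / 3 * dualNorm ip (a i - H (r i)) ^ 2
            + 3 / 2 * dualNorm ip (b i - H (w (i + 1))) ^ 2
            + 2 * dualNorm ip (g i - gradG (md i)) ^ 2)
          + i * ip (g i - gradG (md i)) (v i - r i)
          + i * ip (b i - H (w (i + 1))) (v i - p i)) := by
  have hμ := hdgf.mu_pos
  have hLG := hVI.LG_nonneg
  have hLH := hVI.LH_nonneg
  induction t with
  | zero => simp
  | succ n ih =>
    have hn : 1 ≤ n + 1 := Nat.le_add_left 1 n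
    rw [Finset.sum_Icc_succ_top hn]
    have hγ0 : 0 < γ (n + 1) := hγ ▸ ampGamma_pos hμ hLG hLH hσG hσH hΩ hpos hn
    have hmono := div_ampGamma_le_succ hμ hLG hLH hσG hσH hΩ hpos n
    rw [← hγ] at hmono
    have step := amp_step hVI hdgf (ampAlpha_mem hn).1 (ampAlpha_mem hn).2 hγ0
      (hγ ▸ ampGamma_small hμ hLG hLH hσG hσH hΩ hpos hn) (hr _ hn) (hv _ hn) (hwagZ _ hn) hu
      (hmd _ hn) (hwag _ hn) (hw _ hn) (hr' _ hn) (hp _ hn) (hv' _ hn)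
    have hVr := hV _ (hr _ hn) u hu
    have hVv := hV _ (hv _ hn) u hu
    set c : ℝ := ((n + 1 : ℕ) : ℝ) with hc
    have hn0 : (n : ℝ) = c - 1 := by rw [hc]; push_cast; ring
    have hc0 : 0 < c := by rw [hc]; positivity
    have hα : ampAlpha (n + 1) = 2 / (c + 1) := rfl
    rw [hα] at step
    set A := bregman ip dgf gradDgf (r (n + 1)) u
    set B := bregman ip dgf gradDgf (v (n + 1)) u
    set A' := bregman ip dgf gradDgf (r (n + 1 + 1)) u
    set B' := bregman ip dgf gradDgf (v (n + 1 + 1)) u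
    set q := viQ ip G H J (wag (n + 1)) u
    set q' := viQ ip G H J (wag (n + 1 + 1)) u
    set S := 2 / 3 * dualNorm ip (a (n + 1) - H (r (n + 1))) ^ 2
            + 3 / 2 * dualNorm ip (b (n + 1) - H (w (n + 1 + 1))) ^ 2
            + 2 * dualNorm ip (g (n + 1) - gradG (md (n + 1))) ^ 2
    set X := ip (g (n + 1) - gradG (md (n + 1))) (v (n + 1) - r (n + 1))
    set Y := ip (b (n + 1) - H (w (n + 1 + 1))) (v (n + 1) - p (n + 1))
    set y := γ (n + 1)
    have hm := mul_le_mul_of_nonneg_left step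
      (by positivity : 0 ≤ c * (c + 1) / (2 * y))
    have e1 : c * (c + 1) / (2 * y) * (y * (q' - (1 - 2 / (c + 1)) * q) + 2 / (c + 1) * (A' + B'))
        = c * (c + 1) / 2 * q' - (c - 1) * c / 2 * q + c / y * (A' + B') := by
      field_simp; ring
    have e2 : c * (c + 1) / (2 * y) * (2 / (c + 1) * (A + B + y ^ 2 / μ * S + y * X + y * Y))
        = c / y * (A + B) + (c * y / μ * S + c * X + c * Y) := by
      field_simp; ring
    rw [e1, e2] at hm
    -- Raising the factor of the two distances from the old `t/γ_t` to the new one costs at most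
    -- `2Ω_Z²` times the increase, which is the growth of the first term on the right.
    have hAB := mul_le_mul_of_nonneg_left (add_le_add hVr hVv) (sub_nonneg.2 hmono)
    rw [hn0] at ih hAB
    have e3 : (c - 1) * (c - 1 + 1) / 2 * q = (c - 1) * c / 2 * q := by ring
    rw [e3] at ih
    linarith

/-- The gap function at the averaged iterate is bounded by the accumulated noise. -/
lemma viGap_le_of_viQ_le (hne : Z.Nonempty) {t : ℕ} (ht : 1 ≤ t) {x : E} {B C : ℝ}
    {V : E → ℝ} (hC : 0 ≤ C) (hV : ∀ u ∈ Z, 0 ≤ V u)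
    (h : ∀ u ∈ Z, t * ((t : ℝ) + 1) / 2 * viQ ip G H J x u + C * V u ≤ B) :
    viGap ip Z G H J x ≤ 2 / (t * ((t : ℝ) + 1)) * B := by
  have ht0 : (0 : ℝ) < t := by exact_mod_cast ht
  refine csSup_le (hne.image _) ?_
  rintro _ ⟨u, hu, rfl⟩
  have := h u hu
  have := mul_nonneg hC (hV u hu)
  rw [div_mul_eq_mul_div, le_div_iff₀ (by positivity)]
  linarith

end Telescoping

/-! ### Existence, uniqueness and measurability of prox-mappings. -/

section ProxMeasurable

open Filter Topology

variable {E : Type*} [NormedAddCommGroup E] [NormedSpace ℝ E] {ip : E →L[ℝ] E →L[ℝ] ℝ}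
  {Z : Set E} {μ : ℝ} {dgf : E → ℝ} {gradDgf : E → E} {J : E → ℝ}

/-- Growth of a linear perturbation of a strongly convex function away from its minimizer. -/
lemma IsDistanceGenerating.growth (h : IsDistanceGenerating ip Z μ dgf gradDgf)
    (hJ : ConvexOn ℝ Z J) {ℓ : E →L[ℝ] ℝ} {w u : E} (hw : w ∈ Z)
    (hmin : IsMinOn (fun u => ℓ u + dgf u + J u) Z w) (hu : u ∈ Z) :
    ℓ w + dgf w + J w + μ / 4 * ‖w - u‖ ^ 2 ≤ ℓ u + dgf u + J u := by
  -- Testing at the midpoint is enough; it yields `μ / 4` rather than the sharp `μ / 2`.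
  have h2 : (0 : ℝ) ≤ 1 / 2 := by norm_num
  have h1 : (1 / 2 : ℝ) + 1 / 2 = 1 := by norm_num
  have k1 := h.strongConvex.2 hw hu h2 h2 h1
  have k2 := hJ.2 hw hu h2 h2 h1
  have k3 := isMinOn_iff.1 hmin _ (h.strongConvex.1 hw hu h2 h2 h1)
  simp only [map_add, map_smul, smul_eq_mul] at k1 k2 k3
  linarith

/-- The minimizer of a linear perturbation of a strongly convex function is a continuous
function of the perturbation. -/
lemma IsDistanceGenerating.exists_continuous_argmin
    (h : IsDistanceGenerating ip Z μ dgf gradDgf) (hZ : IsCompact Z) (hne : Z.Nonempty)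
    (hJ : ConvexOn ℝ Z J) (hlsc : LowerSemicontinuousOn J Z) :
    ∃ p : (E →L[ℝ] ℝ) → E, Continuous p ∧
      ∀ ℓ w, (w ∈ Z ∧ IsMinOn (fun u => ℓ u + dgf u + J u) Z w) ↔ w = p ℓ := by
  have hμ := h.mu_pos
  have hdgf : ContinuousOn dgf Z := fun z hz => (h.hasGradient z hz).continuousWithinAt
  have hex : ∀ ℓ : E →L[ℝ] ℝ, ∃ w, w ∈ Z ∧ IsMinOn (fun u => ℓ u + dgf u + J u) Z w := fun ℓ =>
    LowerSemicontinuousOn.exists_isMinOn hne hZ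
      ((ℓ.continuous.continuousOn.add hdgf).lowerSemicontinuousOn.add hlsc)
  choose p hpZ hpmin using hex
  refine ⟨p, ?_, fun ℓ w => ⟨fun ⟨hw, hmin⟩ => ?_, fun hw => hw ▸ ⟨hpZ ℓ, hpmin ℓ⟩⟩⟩
  · refine (LipschitzWith.of_dist_le_mul (K := Real.toNNReal (2 / μ)) fun ℓ ℓ' => ?_).continuous
    -- Adding the growth inequalities of both minimizers gives `(μ/2) d² ≤ ‖ℓ - ℓ'‖ d` for their
    -- distance `d`, whence the Lipschitz constant `2/μ`.
    have k1 := h.growth hJ (hpZ ℓ) (hpmin ℓ) (hpZ ℓ')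
    have k2 := h.growth hJ (hpZ ℓ') (hpmin ℓ') (hpZ ℓ)
    rw [norm_sub_rev] at k2
    have k3 := (le_abs_self _).trans ((ℓ - ℓ').le_opNorm (p ℓ' - p ℓ))
    simp only [sub_apply, map_sub] at k3
    rw [dist_eq_norm, dist_eq_norm]
    rw [Real.coe_toNNReal _ (by positivity), div_mul_eq_mul_div, le_div_iff₀ hμ]
    by_contra hcon
    push Not at hcon
    have k4 : 0 < ‖p ℓ - p ℓ'‖ := by
      by_contra hc
      have : ‖p ℓ - p ℓ'‖ = 0 := le_antisymm (not_lt.1 hc) (norm_nonneg _)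
      rw [this] at hcon
      have := norm_nonneg (ℓ - ℓ')
      linarith
    have k5 := mul_lt_mul_of_pos_right hcon k4
    rw [norm_sub_rev (p ℓ') (p ℓ)] at k3
    nlinarith
  · have k1 := h.growth hJ (hpZ ℓ) (hpmin ℓ) hw
    have k2 := isMinOn_iff.1 hmin _ (hpZ ℓ)
    have k3 : ‖p ℓ - w‖ ^ 2 ≤ 0 := by
      by_contra hc
      have := mul_pos (by positivity : 0 < μ / 4) (not_le.1 hc)
      linarith
    have k4 : ‖p ℓ - w‖ = 0 := pow_eq_zero_iff two_ne_zero |>.1 (le_antisymm k3 (sq_nonneg _))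
    exact (sub_eq_zero.1 (norm_eq_zero.1 k4)).symm

variable [FiniteDimensional ℝ E] [MeasurableSpace E] [BorelSpace E]

/-- A gradient on a convex set is determined, and measurable, along the directions of the set. -/
lemma IsDistanceGenerating.exists_measurable_gradient
    (h : IsDistanceGenerating ip Z μ dgf gradDgf) (hZ : IsClosed Z) (hne : Z.Nonempty) :
    ∃ D : E → (E →L[ℝ] ℝ), Measurable D ∧
      ∀ z ∈ Z, ∀ u ∈ Z, D z (u - z) = ip (gradDgf z) (u - z) := by
  classical
  have := FiniteDimensional.proper ℝ E
  obtain ⟨z₀, hz₀⟩ := hne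
  have hdgf : ContinuousOn dgf Z := fun z hz => (h.hasGradient z hz).continuousWithinAt
  have hZc := h.strongConvex.1
  -- `Z` may have empty interior, and `gradDgf` need not be measurable. Only its pairings with
  -- directions in this span are determined by `dgf`; they are limits of difference quotients, and a
  -- projection onto the span discards the rest.
  let S : Submodule ℝ E := Submodule.span ℝ ((fun u => u - z₀) '' Z)
  have m1 : ∀ u ∈ Z, Measurable fun z : Z => ip (gradDgf z) (u - z) := by
    intro u hu
    refine measurable_of_tendsto_metrizable (f := fun (n : ℕ) (z : Z) =>
      ((n : ℝ) + 1) * (dgf ((z : E) + ((n : ℝ) + 1)⁻¹ • (u - z)) - dgf z)) (fun n => ?_)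
      (tendsto_pi_nhds.2 fun z => HasFDerivWithinAt.tendsto_difference_quotient hZc z.2 hu
        (h.hasGradient z z.2))
    obtain ⟨h0, h1⟩ := one_div_succ_mem n
    refine Continuous.measurable (continuous_const.mul (Continuous.sub ?_ ?_))
    · exact hdgf.comp_continuous (by fun_prop) fun z =>
        hZc.add_smul_sub_mem z.2 hu ⟨h0.le, h1⟩
    · exact hdgf.comp_continuous continuous_subtype_val fun z => z.2
  have m2 : ∀ v ∈ S, Measurable fun z : Z => ip (gradDgf z) v := by
    intro v hv
    induction hv using Submodule.span_induction with
    | mem x hx =>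
      obtain ⟨u, hu, rfl⟩ := hx
      have : (fun z : Z => ip (gradDgf z) (u - z₀))
          = fun z : Z => ip (gradDgf z) (u - z) - ip (gradDgf z) (z₀ - z) := by
        funext z; rw [← map_sub, sub_sub_sub_cancel_right]
      simp only
      rw [this]
      exact (m1 u hu).sub (m1 z₀ hz₀)
    | zero => simp
    | add x y _ _ hx hy => simp only [map_add]; exact hx.add hy
    | smul c x _ hx => simpa using hx.const_mul c
  obtain ⟨π, hπ⟩ := S.exists_isCompl
  let proj : E →L[ℝ] E := LinearMap.toContinuousLinearMap (S.subtype ∘ₗ S.projectionOnto π hπ)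
  have hproj : ∀ x, proj x ∈ S := fun x => by simp [proj]
  have hproj' : ∀ x ∈ S, proj x = x := fun x hx => by
    have := Submodule.projectionOnto_apply_left hπ ⟨x, hx⟩
    simp only at this
    simp [proj, this]
  let D' : Z → (E →L[ℝ] ℝ) := fun z => (ip (gradDgf z)).comp proj
  have hD' : Measurable D' := by
    let b := Module.finBasis ℝ E
    have e : D' = fun z : Z => ∑ i, ip (gradDgf z) (proj (b i)) •
        LinearMap.toContinuousLinearMap (b.coord i) := by
      funext z
      refine ContinuousLinearMap.coe_injective (b.ext fun j => ?_)
      simp [D', Finsupp.single_apply]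
    rw [e]
    exact Finset.measurable_sum _ fun i _ => (m2 _ (hproj _)).smul_const _
  refine ⟨fun z => if hz : z ∈ Z then D' ⟨z, hz⟩ else 0, ?_, fun z hz u hu => ?_⟩
  · exact Measurable.dite (s := Z) hD' measurable_const hZ.measurableSet
  · have hS : u - z ∈ S := by
      have e : u - z = (u - z₀) - (z - z₀) := by abel
      rw [e]
      exact S.sub_mem (Submodule.subset_span ⟨u, hu, rfl⟩) (Submodule.subset_span ⟨z, hz, rfl⟩)
    simp [hz, D', hproj' _ hS]

/-- The prox-mapping is a well-defined, jointly measurable function. -/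
lemma IsDistanceGenerating.exists_measurable_prox
    (h : IsDistanceGenerating ip Z μ dgf gradDgf) (hZ : IsCompact Z) (hne : Z.Nonempty)
    (hJ : ConvexOn ℝ Z J) (hlsc : LowerSemicontinuousOn J Z) :
    ∃ pr : E → E → E, Measurable (Function.uncurry pr) ∧
      ∀ z ∈ Z, ∀ η w, IsProx ip Z dgf gradDgf J z η w ↔ w = pr z η := by
  have := FiniteDimensional.proper ℝ E
  obtain ⟨p, hp, hpmin⟩ := h.exists_continuous_argmin hZ hne hJ hlsc
  obtain ⟨D, hD, hDg⟩ := h.exists_measurable_gradient hZ.isClosed hne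
  refine ⟨fun z η => p (ip η - D z), ?_, fun z hz η w => ?_⟩
  · refine hp.measurable.comp (Measurable.sub ?_ (hD.comp measurable_fst))
    exact ip.continuous.measurable.comp measurable_snd
  · rw [← hpmin]
    refine and_congr_right fun hw => ?_
    -- Up to a constant in `u`, the prox objective is `dgf + J` perturbed by the functional `ip η -
    -- D z`; thus the prox-mapping is a continuous map composed with a measurable one.
    have e : ∀ u ∈ Z, ip η (u - z) + bregman ip dgf gradDgf z u + J u
        = ((ip η - D z) u + dgf u + J u) + (D z z - ip η z - dgf z) := by
      intro u hu
      unfold bregman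
      rw [← hDg z hz u hu]
      simp only [map_sub, sub_apply]
      ring
    rw [isMinOn_iff, isMinOn_iff]
    refine forall₂_congr fun u hu => ?_
    rw [e u hu, e w hw, add_le_add_iff_right]

end ProxMeasurable

/-- The operators are controlled only on `Z`, where all iterates lie; their values elsewhere may be
altered to make them measurable on the whole space. -/
lemma exists_measurable_extension {E : Type*} [NormedAddCommGroup E] [MeasurableSpace E]
    [BorelSpace E] {Z : Set E} (hZ : IsClosed Z)
    {F : E → E} (hF : ContinuousOn F Z) : ∃ F' : E → E, Measurable F' ∧ ∀ x ∈ Z, F' x = F x := by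
  classical
  exact ⟨Z.piecewise F 0, hF.measurable_piecewise continuousOn_const hZ.measurableSet,
    fun x hx => by simp [hx]⟩

/-! ### Finiteness and measurability of the gap function. -/

section Gap

open Filter Topology

variable {E : Type*} [NormedAddCommGroup E] [NormedSpace ℝ E] {ip : E →L[ℝ] E →L[ℝ] ℝ}
  {Z : Set E} {μ : ℝ} {dgf : E → ℝ} {gradDgf : E → E} {G : E → ℝ} {gradG H : E → E} {J : E → ℝ}
  {LG LH ΩZ : ℝ}

lemma norm_sub_le_of_bregman_le (h : IsDistanceGenerating ip Z μ dgf gradDgf)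
    (hV : ∀ z₁ ∈ Z, ∀ z₂ ∈ Z, bregman ip dgf gradDgf z₁ z₂ ≤ ΩZ ^ 2)
    {z u : E} (hz : z ∈ Z) (hu : u ∈ Z) : ‖u - z‖ ≤ Real.sqrt (2 * ΩZ ^ 2 / μ) := by
  have h1 := (h.le_bregman hz hu).trans (hV z hz u hu)
  refine Real.le_sqrt_of_sq_le ?_
  rw [le_div_iff₀ h.mu_pos]
  linarith

lemma isCompact_of_bregman_le [FiniteDimensional ℝ E] (hZ : IsClosed Z)
    (h : IsDistanceGenerating ip Z μ dgf gradDgf)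
    (hV : ∀ z₁ ∈ Z, ∀ z₂ ∈ Z, bregman ip dgf gradDgf z₁ z₂ ≤ ΩZ ^ 2) : IsCompact Z := by
  have := FiniteDimensional.proper ℝ E
  refine Metric.isCompact_of_isClosed_isBounded hZ (Metric.isBounded_iff.2
    ⟨Real.sqrt (2 * ΩZ ^ 2 / μ), fun x hx y hy => ?_⟩)
  rw [dist_eq_norm]
  exact norm_sub_le_of_bregman_le h hV hy hx

lemma IsVIProblem.continuousOn_ip (hVI : IsVIProblem ip Z G gradG H J LG LH) :
    ContinuousOn (fun u => ip (H u)) Z := by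
  have : LipschitzOnWith (Real.toNNReal LH) (fun u => ip (H u)) Z := by
    refine LipschitzOnWith.of_dist_le_mul fun x hx y hy => ?_
    rw [dist_eq_norm, dist_eq_norm, Real.coe_toNNReal _ hVI.LH_nonneg, ← map_sub]
    exact hVI.lipschitz x hx y hy
  exact this.continuousOn

/-- The Lipschitz condition concerns the functionals `ip (H u)`. Positivity makes `x ↦ ip x`
injective, and in finite dimension it has a continuous linear left inverse. -/
lemma IsVIProblem.continuousOn_operator [FiniteDimensional ℝ E] (hip : IsInnerProduct ip)
    (hVI : IsVIProblem ip Z G gradG H J LG LH) : ContinuousOn H Z := by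
  have hker : LinearMap.ker (ip : E →ₗ[ℝ] (E →L[ℝ] ℝ)) = ⊥ := by
    refine LinearMap.ker_eq_bot'.2 fun x hx => ?_
    by_contra hne
    have := hip.pos x hne
    have hx' : ip x = 0 := hx
    rw [hx'] at this
    simp at this
  obtain ⟨g, hg⟩ := LinearMap.exists_leftInverse_of_injective _ hker
  have hgc : Continuous g := LinearMap.continuous_of_finiteDimensional g
  have e : H = fun u => g (ip (H u)) := by
    funext u
    exact (LinearMap.congr_fun hg (H u)).symm
  rw [e]
  exact hgc.comp_continuousOn hVI.continuousOn_ip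

/-- On the compact set `Z` the terms in `G` and `H` are continuous in `u`; `J` is merely lower
semicontinuous, but it enters with a minus sign. -/
lemma bddAbove_viQ (hVI : IsVIProblem ip Z G gradG H J LG LH) (hZ : IsCompact Z) (x : E) :
    BddAbove ((fun u => viQ ip G H J x u) '' Z) := by
  have hG : ContinuousOn G Z := fun z hz => (hVI.hasGradient z hz).continuousWithinAt
  have h1 : ContinuousOn (fun u => ip (H u) (x - u) - G u) Z :=
    (hVI.continuousOn_ip.clm_apply (by fun_prop)).sub hG
  obtain ⟨A, hA⟩ := (hZ.image_of_continuousOn h1).bddAbove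
  obtain ⟨B, hB⟩ := hVI.lscJ.bddBelow_of_isCompact hZ
  refine ⟨G x + J x + A - B, ?_⟩
  rintro _ ⟨u, hu, rfl⟩
  have k1 := hA ⟨u, hu, rfl⟩
  have k2 := hB ⟨u, hu, rfl⟩
  simp only [viQ] at k1 k2 ⊢
  linarith

lemma viGap_nonneg (hVI : IsVIProblem ip Z G gradG H J LG LH) (hZ : IsCompact Z) {x : E}
    (hx : x ∈ Z) : 0 ≤ viGap ip Z G H J x := by
  refine le_csSup (bddAbove_viQ hVI hZ x) ⟨x, hx, ?_⟩
  simp [viQ]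

/-- The supremum runs over an uncountable set, but `Q(·, u)` is lower semicontinuous, so the
superlevel set is a union of relatively open sets. -/
lemma measurableSet_viGap_gt [MeasurableSpace E] [BorelSpace E]
    (hVI : IsVIProblem ip Z G gradG H J LG LH) (hZ : IsCompact Z) (c : ℝ) :
    MeasurableSet (Z ∩ {x | c < viGap ip Z G H J x}) := by
  have hG : ContinuousOn G Z := fun z hz => (hVI.hasGradient z hz).continuousWithinAt
  have hQ : ∀ u : E, LowerSemicontinuousOn (fun x => viQ ip G H J x u) Z := by
    intro u
    have h1 : ContinuousOn (fun x => G x - G u + ip (H u) (x - u) - J u) Z :=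
      ((hG.sub continuousOn_const).add (by fun_prop)).sub continuousOn_const
    have h2 := h1.lowerSemicontinuousOn.add hVI.lscJ
    have e : (fun x => viQ ip G H J x u)
        = fun x => (G x - G u + ip (H u) (x - u) - J u) + J x := by
      funext x; unfold viQ; ring
    rw [e]
    exact h2
  choose O hO hOeq using fun u => lowerSemicontinuousOn_iff_preimage_Ioi.1 (hQ u) c
  have e : Z ∩ {x | c < viGap ip Z G H J x} = Z ∩ ⋃ u ∈ Z, O u := by
    ext x
    simp only [Set.mem_inter_iff, Set.mem_ofPred_eq, Set.mem_iUnion, exists_prop]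
    refine and_congr_right fun hx => ?_
    have hmem : ∀ u, x ∈ O u ↔ c < viQ ip G H J x u := fun u => by
      have := Set.ext_iff.1 (hOeq u) x
      simp only [Set.mem_inter_iff, Set.mem_preimage, Set.mem_Ioi, hx, true_and] at this
      exact this.symm
    simp only [hmem]
    constructor
    · intro hc
      obtain ⟨_, ⟨u, hu, rfl⟩, hlt⟩ := exists_lt_of_lt_csSup (hVI.nonempty.image _) hc
      exact ⟨u, hu, hlt⟩
    · rintro ⟨u, hu, hlt⟩
      exact hlt.trans_le (le_csSup (bddAbove_viQ hVI hZ x) ⟨u, hu, rfl⟩)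
  rw [e]
  exact hVI.isClosed.measurableSet.inter (isOpen_biUnion fun u _ => hO u).measurableSet

lemma measurable_viGap_comp [MeasurableSpace E] [BorelSpace E] {Ω : Type*} [MeasurableSpace Ω]
    (hVI : IsVIProblem ip Z G gradG H J LG LH) (hZ : IsCompact Z) {x : Ω → E}
    (hx : Measurable x) (hxZ : ∀ ω, x ω ∈ Z) :
    Measurable fun ω => viGap ip Z G H J (x ω) := by
  refine measurable_of_Ioi fun c => ?_
  have := hx (measurableSet_viGap_gt hVI hZ c)
  convert this using 1
  ext ω
  simp [hxZ ω]

end Gap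

lemma measureReal_gt_le_exp {Ω : Type*} [MeasurableSpace Ω] {P : Measure Ω} {f : Ω → ℝ} (hf : AEMeasurable f P) {a b : ℝ}
    (h : ∫⁻ ω, ENNReal.ofReal (Real.exp (f ω)) ∂P ≤ ENNReal.ofReal (Real.exp b)) :
    P.real {ω | a < f ω} ≤ Real.exp (b - a) := by
  have hm : AEMeasurable (fun ω => ENNReal.ofReal (Real.exp (f ω))) P :=
    (Real.measurable_exp.comp_aemeasurable hf).ennreal_ofReal
  have h1 := meas_ge_le_lintegral_div hm (ε := ENNReal.ofReal (Real.exp a))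
    (by simpa using Real.exp_pos a) ENNReal.ofReal_ne_top
  have h2 : P {ω | a < f ω} ≤ ENNReal.ofReal (Real.exp (b - a)) := by
    refine (measure_mono fun ω hω => ?_).trans (h1.trans ?_)
    · exact ENNReal.ofReal_le_ofReal (Real.exp_le_exp.2 (le_of_lt hω))
    · rw [Real.exp_sub, ENNReal.ofReal_div_of_pos (Real.exp_pos a)]
      gcongr
  exact ENNReal.toReal_le_of_le_ofReal (Real.exp_pos _).le h2

/-! ### Independence and exponential moments. -/

section Probability

variable {Ω α β : Type*} [MeasurableSpace Ω] [MeasurableSpace α] [MeasurableSpace β]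
  {P : Measure Ω} [IsProbabilityMeasure P]

/-- The joint law is a product, so Tonelli integrates over `X` with `U` frozen. This takes the place
of conditional expectations throughout. -/
lemma ProbabilityTheory.IndepFun.lintegral_comp_prodMk {U : Ω → α} {X : Ω → β}
    (hU : Measurable U) (hX : Measurable X) (h : IndepFun U X P) {f : α × β → ENNReal}
    (hf : Measurable f) :
    ∫⁻ ω, f (U ω, X ω) ∂P = ∫⁻ ω, ∫⁻ ω', f (U ω, X ω') ∂P ∂P := by
  have e := (indepFun_iff_map_prod_eq_prod_map_map hU.aemeasurable hX.aemeasurable).1 h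
  have := Measure.isProbabilityMeasure_map (μ := P) hX.aemeasurable
  rw [← lintegral_map (μ := P) (g := fun ω => (U ω, X ω)) hf (hU.prodMk hX), e,
    lintegral_prod _ hf.aemeasurable, lintegral_map hf.lintegral_prod_right' hU]
  refine lintegral_congr fun ω => ?_
  exact lintegral_map (f := fun y => f (U ω, y)) (hf.comp measurable_prodMk_left) hX

lemma ProbabilityTheory.IndepFun.integral_comp_prodMk_eq_zero {U : Ω → α} {X : Ω → β}
    (hU : Measurable U) (hX : Measurable X) (h : IndepFun U X P) {f : α × β → ℝ}
    (hf : Measurable f) (hint : Integrable (fun ω => f (U ω, X ω)) P)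
    (h0 : ∀ ω, ∫ ω', f (U ω, X ω') ∂P = 0) : ∫ ω, f (U ω, X ω) ∂P = 0 := by
  have e := (indepFun_iff_map_prod_eq_prod_map_map hU.aemeasurable hX.aemeasurable).1 h
  have := Measure.isProbabilityMeasure_map (μ := P) hX.aemeasurable
  have := Measure.isProbabilityMeasure_map (μ := P) hU.aemeasurable
  have hUX := hU.prodMk hX
  have hint' : Integrable f ((P.map U).prod (P.map X)) := by
    rw [← e]
    exact (integrable_map_measure hf.aestronglyMeasurable hUX.aemeasurable).2 hint
  rw [← integral_map (μ := P) (φ := fun ω => (U ω, X ω)) hUX.aemeasurable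
    hf.aestronglyMeasurable, e, integral_prod _ hint', integral_map hU.aemeasurable
    hf.stronglyMeasurable.integral_prod_right'.aestronglyMeasurable]
  rw [← integral_zero Ω ℝ]
  refine integral_congr_ae (Filter.Eventually.of_forall fun ω => ?_)
  simp only
  rw [integral_map (f := fun y => f (U ω, y)) hX.aemeasurable
    (hf.comp measurable_prodMk_left).aestronglyMeasurable, h0]

/-- For `|x| ≤ 1` use `exp x ≤ 1 + x + x²`; for `x > 1` use `x ≤ x²`; for `x < -1` use `exp x ≤ 1 ≤
x + x² + 1`. -/
lemma exp_le_add_exp_sq (x : ℝ) : Real.exp x ≤ x + Real.exp (x ^ 2) := by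
  rcases le_or_gt |x| 1 with h | h
  · have h1 := (abs_le.1 (Real.abs_exp_sub_one_sub_id_le h)).2
    have h2 := Real.add_one_le_exp (x ^ 2)
    linarith
  · rcases lt_abs.1 h with h | h
    · have : Real.exp x ≤ Real.exp (x ^ 2) := Real.exp_le_exp.2 (by nlinarith)
      linarith
    · have h1 : Real.exp x ≤ 1 := Real.exp_le_one_iff.2 (by linarith)
      have h2 := Real.add_one_le_exp (x ^ 2)
      nlinarith

/-- Convexity of `exp` between `y - 1` and `0`. The shift by `1` fits the normalisation `E exp Y ≤
exp 1`: the bracket then has mean at most `1`. -/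
lemma exp_mul_le {κ y : ℝ} (h0 : 0 ≤ κ) (h1 : κ ≤ 1) :
    Real.exp (κ * y) ≤ Real.exp κ * (κ * Real.exp (y - 1) + (1 - κ)) := by
  have h := convexOn_exp.2 (Set.mem_univ (y - 1)) (Set.mem_univ 0) h0 (sub_nonneg.2 h1)
    (by ring)
  simp only [smul_eq_mul, mul_zero, add_zero, Real.exp_zero, mul_one] at h
  have e : κ * y = κ + κ * (y - 1) := by ring
  rw [e, Real.exp_add]
  gcongr

/-- A centered random variable dominated by one with a light tail is sub-Gaussian. -/
lemma lintegral_exp_le_of_sq_le {X Y : Ω → ℝ} {κ : ℝ} (hκ : 0 ≤ κ) (hX : Integrable X P)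
    (hX0 : ∫ ω, X ω ∂P = 0) (hY : AEMeasurable Y P) (hY0 : ∀ ω, 0 ≤ Y ω)
    (hXY : ∀ᵐ ω ∂P, X ω ^ 2 ≤ κ * Y ω)
    (hexp : ∫⁻ ω, ENNReal.ofReal (Real.exp (Y ω)) ∂P ≤ ENNReal.ofReal (Real.exp 1)) :
    ∫⁻ ω, ENNReal.ofReal (Real.exp (X ω)) ∂P ≤ ENNReal.ofReal (Real.exp κ) := by
  have hYm := Real.measurable_exp.comp_aemeasurable hY
  have hYint : Integrable (fun ω => Real.exp (Y ω)) P := by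
    refine ⟨hYm.aestronglyMeasurable, ?_⟩
    rw [hasFiniteIntegral_iff_ofReal (Filter.Eventually.of_forall fun ω => (Real.exp_pos _).le)]
    exact hexp.trans_lt ENNReal.ofReal_lt_top
  have hYle : ∫ ω, Real.exp (Y ω) ∂P ≤ Real.exp 1 := by
    rw [integral_eq_lintegral_of_nonneg_ae
      (Filter.Eventually.of_forall fun ω => (Real.exp_pos _).le) hYm.aestronglyMeasurable]
    exact ENNReal.toReal_le_of_le_ofReal (Real.exp_pos _).le hexp
  -- It suffices to dominate `exp X` pointwise: the linear term in `X` integrates to `0` and `exp (Y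
  -- - 1)` to at most `1`.
  have key : ∀ a A B : ℝ, 0 ≤ A → A + B ≤ Real.exp κ →
      (∀ᵐ ω ∂P, Real.exp (X ω) ≤ a * X ω + A * Real.exp (Y ω - 1) + B) →
      ∫⁻ ω, ENNReal.ofReal (Real.exp (X ω)) ∂P ≤ ENNReal.ofReal (Real.exp κ) := by
    intro a A B hA hAB h
    have e : (fun ω => a * X ω + A * Real.exp (Y ω - 1) + B)
        = fun ω => a * X ω + A * Real.exp (-1) * Real.exp (Y ω) + B := by
      funext ω; rw [Real.exp_sub, Real.exp_neg]; ring
    have i1 : Integrable (fun ω => a * X ω + A * Real.exp (-1) * Real.exp (Y ω)) P :=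
      (hX.const_mul a).add (hYint.const_mul _)
    have hint : Integrable (fun ω => a * X ω + A * Real.exp (Y ω - 1) + B) P := by
      rw [e]
      exact i1.add (integrable_const B)
    calc _ ≤ ∫⁻ ω, ENNReal.ofReal (a * X ω + A * Real.exp (Y ω - 1) + B) ∂P :=
          lintegral_mono_ae (h.mono fun ω hω => ENNReal.ofReal_le_ofReal hω)
      _ = ENNReal.ofReal (∫ ω, (a * X ω + A * Real.exp (Y ω - 1) + B) ∂P) :=
          (ofReal_integral_eq_lintegral_ofReal hint
            (h.mono fun ω hω => (Real.exp_pos _).le.trans hω)).symm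
      _ ≤ _ := by
          refine ENNReal.ofReal_le_ofReal (le_trans ?_ hAB)
          rw [e, integral_add i1 (integrable_const B),
            integral_add (hX.const_mul a) (hYint.const_mul _), integral_const_mul,
            integral_const_mul, hX0]
          have : A * Real.exp (-1) * ∫ ω, Real.exp (Y ω) ∂P ≤ A := by
            calc _ ≤ A * Real.exp (-1) * Real.exp 1 := by gcongr
              _ = A := by rw [mul_assoc, ← Real.exp_add]; simp
          simp only [mul_zero, zero_add, integral_const, probReal_univ, one_smul]
          linarith
  -- For `κ ≤ 1` the linear term is split off and `exp (κ Y)` is interpolated; for `κ > 1` the bound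
  -- `X ≤ κ/2 + Y/2` is enough, with `exp (κ/2 + 1/2) ≤ exp κ`.
  rcases le_or_gt κ 1 with h1 | h1
  · refine key 1 (Real.exp κ * κ) (Real.exp κ * (1 - κ)) (by positivity) (by linarith) ?_
    filter_upwards [hXY] with ω hω
    have k1 := exp_le_add_exp_sq (X ω)
    have k2 := Real.exp_le_exp.2 hω
    have k3 := exp_mul_le (y := Y ω) hκ h1
    linarith
  · refine key 0 (Real.exp (κ / 2) * (Real.exp (1 / 2) * (1 / 2)))
      (Real.exp (κ / 2) * (Real.exp (1 / 2) * (1 / 2))) (by positivity) ?_ ?_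
    · have : Real.exp (κ / 2) * Real.exp (1 / 2) ≤ Real.exp κ := by
        rw [← Real.exp_add]
        exact Real.exp_le_exp.2 (by linarith)
      linarith
    · filter_upwards [hXY] with ω hω
      have k1 : X ω ≤ κ / 2 + 1 / 2 * Y ω := by
        refine le_of_abs_le (abs_le_of_sq_le_sq ?_ (by have := hY0 ω; positivity))
        nlinarith [sq_nonneg (κ - Y ω)]
      have k2 := Real.exp_le_exp.2 k1
      have k3 := exp_mul_le (κ := 1 / 2) (y := Y ω) (by norm_num) (by norm_num)
      rw [Real.exp_add] at k2
      have k4 := mul_le_mul_of_nonneg_left k3 (Real.exp_pos (κ / 2)).le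
      linarith

/-- A weighted sum of random variables with light tails has a light tail. -/
lemma measureReal_sum_gt_le {ι : Type*} (s : Finset ι) {c : ι → ℝ} {Y : ι → Ω → ℝ}
    (hc : ∀ i ∈ s, 0 ≤ c i) (hY : ∀ i ∈ s, AEMeasurable (Y i) P)
    (hexp : ∀ i ∈ s, ∫⁻ ω, ENNReal.ofReal (Real.exp (Y i ω)) ∂P ≤ ENNReal.ofReal (Real.exp 1))
    (lam : ℝ) :
    P.real {ω | (1 + lam) * ∑ i ∈ s, c i < ∑ i ∈ s, c i * Y i ω} ≤ Real.exp (-lam) := by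
  rcases (Finset.sum_nonneg hc).eq_or_lt with h0 | h0
  · have hz := (Finset.sum_eq_zero_iff_of_nonneg hc).1 h0.symm
    have : {ω | (1 + lam) * ∑ i ∈ s, c i < ∑ i ∈ s, c i * Y i ω} = ∅ := by
      ext ω
      have : ∑ i ∈ s, c i * Y i ω = 0 :=
        Finset.sum_eq_zero fun i hi => by rw [hz i hi, zero_mul]
      simp [← h0, this]
    rw [this]
    simpa using (Real.exp_pos _).le
  set C := ∑ i ∈ s, c i with hC
  have hw1 : ∑ i ∈ s, c i / C = 1 := by rw [← Finset.sum_div, ← hC, div_self h0.ne']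
  have hw0 : ∀ i ∈ s, 0 ≤ c i / C := fun i hi => div_nonneg (hc i hi) h0.le
  have hm : AEMeasurable (fun ω => ∑ i ∈ s, c i / C * Y i ω) P :=
    Finset.aemeasurable_fun_sum s fun i hi => (hY i hi).const_mul _
  -- Jensen's inequality with the weights `c i / C`; no independence among the `Y i` enters.
  have hint : ∫⁻ ω, ENNReal.ofReal (Real.exp (∑ i ∈ s, c i / C * Y i ω)) ∂P
      ≤ ENNReal.ofReal (Real.exp 1) := by
    calc _ ≤ ∫⁻ ω, ∑ i ∈ s, ENNReal.ofReal (c i / C) * ENNReal.ofReal (Real.exp (Y i ω)) ∂P := by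
          refine lintegral_mono fun ω => ?_
          have := convexOn_exp.map_sum_le hw0 hw1 (p := fun i => Y i ω) (by simp)
          simp only [smul_eq_mul] at this
          refine (ENNReal.ofReal_le_ofReal this).trans ?_
          rw [ENNReal.ofReal_sum_of_nonneg fun i hi =>
            mul_nonneg (hw0 i hi) (Real.exp_pos _).le]
          exact Finset.sum_le_sum fun i hi => (ENNReal.ofReal_mul (hw0 i hi)).le
      _ = ∑ i ∈ s, ENNReal.ofReal (c i / C) * ∫⁻ ω, ENNReal.ofReal (Real.exp (Y i ω)) ∂P := by
          rw [lintegral_finsetSum' s (f := fun i ω => ENNReal.ofReal (c i / C)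
            * ENNReal.ofReal (Real.exp (Y i ω))) fun i hi =>
            ((Real.measurable_exp.comp_aemeasurable (hY i hi)).ennreal_ofReal).const_mul _]
          refine Finset.sum_congr rfl fun i hi => ?_
          rw [lintegral_const_mul' _ _ ENNReal.ofReal_ne_top]
      _ ≤ ∑ i ∈ s, ENNReal.ofReal (c i / C) * ENNReal.ofReal (Real.exp 1) :=
          Finset.sum_le_sum fun i hi => by gcongr; exact hexp i hi
      _ = ENNReal.ofReal (Real.exp 1) := by
          rw [← Finset.sum_mul, ← ENNReal.ofReal_sum_of_nonneg hw0, hw1]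
          simp
  have := measureReal_gt_le_exp hm (a := 1 + lam) hint
  have e : (1 : ℝ) - (1 + lam) = -lam := by ring
  rw [e] at this
  refine le_trans (measureReal_mono fun ω hω => ?_) this
  have hω' : (1 + lam) * C < ∑ i ∈ s, c i * Y i ω := hω
  have e2 : ∑ i ∈ s, c i / C * Y i ω = (∑ i ∈ s, c i * Y i ω) / C := by
    rw [Finset.sum_div]
    exact Finset.sum_congr rfl fun i _ => by ring
  change 1 + lam < ∑ i ∈ s, c i / C * Y i ω
  rw [e2, lt_div_iff₀ h0]
  exact hω'

end Probability

/-! ### Oracle noise at random points. -/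

section Oracle

lemma integral_ip_noise {E Ω Ξ : Type*} [NormedAddCommGroup E] [NormedSpace ℝ E]
    [FiniteDimensional ℝ E] [MeasurableSpace Ω] {P : Measure Ω} [IsProbabilityMeasure P]
    {ip : E →L[ℝ] E →L[ℝ] ℝ} {F : E → E} {Fs : E → Ξ → E} {X : Ω → Ξ} {z : E} (hint : Integrable (fun ω => Fs z (X ω)) P)
    (h0 : ∫ ω, Fs z (X ω) ∂P = F z) (q : E) :
    Integrable (fun ω => ip (Fs z (X ω) - F z) q) P ∧
      ∫ ω, ip (Fs z (X ω) - F z) q ∂P = 0 := by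
  have := FiniteDimensional.complete ℝ E
  have h1 : Integrable (fun ω => Fs z (X ω) - F z) P := hint.sub (integrable_const _)
  refine ⟨(ip.flip q).integrable_comp h1, ?_⟩
  have := (ip.flip q).integral_comp_comm h1
  simp only [ContinuousLinearMap.flip_apply] at this
  rw [this, integral_sub hint (integrable_const _), h0]
  simp

lemma indepFun_of_indep {Ω α β : Type*} [MeasurableSpace Ω] {P : Measure Ω} [MeasurableSpace α] [MeasurableSpace β]
    {m : MeasurableSpace Ω} {U : Ω → α} {X : Ω → β} (hU : Measurable[m] U)
    (h : Indep m (MeasurableSpace.comap X inferInstance) P) : IndepFun U X P :=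
  (IndepFun_iff_Indep _ _ _).2 (indep_of_indep_of_le_left h hU.comap_le)

variable {E Ω Ξ : Type*} [NormedAddCommGroup E] [NormedSpace ℝ E] [FiniteDimensional ℝ E]
  [MeasurableSpace E] [BorelSpace E] [MeasurableSpace Ω] [MeasurableSpace Ξ] {P : Measure Ω}
  [IsProbabilityMeasure P] {ip : E →L[ℝ] E →L[ℝ] ℝ} {Z : Set E} {F : E → E} {Fs : E → Ξ → E}
  {σ R : ℝ}

lemma continuous_dualNorm {E : Type*} [NormedAddCommGroup E] [NormedSpace ℝ E]
    (ip : E →L[ℝ] E →L[ℝ] ℝ) : Continuous (dualNorm ip) :=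
  ip.continuous.norm

lemma measurable_noise {Ω : Type*} (hFs : Measurable (Function.uncurry Fs)) (hF : Measurable F)
    {m : MeasurableSpace Ω} {x : Ω → E} {X : Ω → Ξ} (hx : Measurable x) (hX : Measurable X) :
    Measurable fun ω => Fs (x ω) (X ω) - F (x ω) := by
  have := FiniteDimensional.proper ℝ E
  exact (hFs.comp (hx.prodMk hX)).sub (hF.comp hx)

lemma measurable_ip (ip : E →L[ℝ] E →L[ℝ] ℝ) {α : Type*} {m : MeasurableSpace α} {x y : α → E}
    (hx : Measurable x) (hy : Measurable y) : Measurable fun ω => ip (x ω) (y ω) := by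
  have := FiniteDimensional.proper ℝ E
  have : Continuous fun q : E × E => ip q.1 q.2 := by fun_prop
  exact this.measurable.comp (hx.prodMk hy)

/-- A bound on a moment of the noise at every deterministic point carries over to random points
that are independent of the oracle call. -/
lemma lintegral_noise_le (hFs : Measurable (Function.uncurry Fs)) (hF : Measurable F)
    {x : Ω → E} {X : Ω → Ξ} (hx : Measurable x) (hX : Measurable X) (hxZ : ∀ ω, x ω ∈ Z)
    (hind : IndepFun x X P) {φ : E → ENNReal} (hφ : Measurable φ) {B : ENNReal}
    (h : ∀ z ∈ Z, ∫⁻ ω, φ (Fs z (X ω) - F z) ∂P ≤ B) :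
    ∫⁻ ω, φ (Fs (x ω) (X ω) - F (x ω)) ∂P ≤ B := by
  have hf : Measurable fun q : E × Ξ => φ (Fs q.1 q.2 - F q.1) :=
    hφ.comp (measurable_noise hFs hF measurable_fst measurable_snd)
  rw [hind.lintegral_comp_prodMk hx hX hf]
  calc _ ≤ ∫⁻ _, B ∂P := lintegral_mono fun ω => h _ (hxZ ω)
    _ = B := by simp

lemma integrable_noise_sq (hFs : Measurable (Function.uncurry Fs)) (hF : Measurable F)
    {x : Ω → E} {X : Ω → Ξ} (hx : Measurable x) (hX : Measurable X) (hxZ : ∀ ω, x ω ∈ Z)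
    (hind : IndepFun x X P)
    (h : ∀ z ∈ Z, ∫⁻ ω, ENNReal.ofReal (dualNorm ip (Fs z (X ω) - F z) ^ 2) ∂P
      ≤ ENNReal.ofReal (σ ^ 2)) :
    Integrable (fun ω => dualNorm ip (Fs (x ω) (X ω) - F (x ω)) ^ 2) P ∧
      ∫ ω, dualNorm ip (Fs (x ω) (X ω) - F (x ω)) ^ 2 ∂P ≤ σ ^ 2 := by
  have hd := (continuous_dualNorm ip).measurable
  have hle := lintegral_noise_le hFs hF hx hX hxZ hind
    (φ := fun n => ENNReal.ofReal (dualNorm ip n ^ 2)) (hd.pow_const 2).ennreal_ofReal h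
  have hm : Measurable fun ω => dualNorm ip (Fs (x ω) (X ω) - F (x ω)) ^ 2 :=
    (hd.comp (measurable_noise hFs hF hx hX)).pow_const 2
  have h0 : 0 ≤ᵐ[P] fun ω => dualNorm ip (Fs (x ω) (X ω) - F (x ω)) ^ 2 :=
    Filter.Eventually.of_forall fun ω => sq_nonneg _
  refine ⟨⟨hm.aestronglyMeasurable, ?_⟩, ?_⟩
  · rw [hasFiniteIntegral_iff_ofReal h0]
    exact hle.trans_lt ENNReal.ofReal_lt_top
  · rw [integral_eq_lintegral_of_nonneg_ae h0 hm.aestronglyMeasurable]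
    exact ENNReal.toReal_le_of_le_ofReal (sq_nonneg _) hle

/-- The noise of an unbiased oracle is orthogonal to directions independent of the call. -/
lemma integrable_ip_noise (hFs : Measurable (Function.uncurry Fs)) (hF : Measurable F)
    {x p : Ω → E} {X : Ω → Ξ} (hx : Measurable x) (hp : Measurable p) (hX : Measurable X)
    (hxZ : ∀ ω, x ω ∈ Z) (hpR : ∀ ω, ‖p ω‖ ≤ R)
    (hind : IndepFun (fun ω => (x ω, p ω)) X P)
    (hint : ∀ z ∈ Z, Integrable (fun ω => Fs z (X ω)) P)
    (h0 : ∀ z ∈ Z, ∫ ω, Fs z (X ω) ∂P = F z)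
    (hsq : Integrable (fun ω => dualNorm ip (Fs (x ω) (X ω) - F (x ω)) ^ 2) P) :
    Integrable (fun ω => ip (Fs (x ω) (X ω) - F (x ω)) (p ω)) P ∧
      ∫ ω, ip (Fs (x ω) (X ω) - F (x ω)) (p ω) ∂P = 0 := by
  have hm : Measurable fun q : (E × E) × Ξ => ip (Fs q.1.1 q.2 - F q.1.1) q.1.2 :=
    measurable_ip ip (measurable_noise hFs hF (measurable_fst.comp measurable_fst) measurable_snd)
      (measurable_snd.comp measurable_fst)
  have hi : Integrable (fun ω => ip (Fs (x ω) (X ω) - F (x ω)) (p ω)) P := by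
    -- The pairing is dominated by `(d² + 1) R`, where `d ≤ d² + 1` is the dual norm of the noise.
    refine ((hsq.add (integrable_const 1)).mul_const R).mono'
      (measurable_ip ip (measurable_noise hFs hF hx hX) hp).aestronglyMeasurable
      (Filter.Eventually.of_forall fun ω => ?_)
    refine (abs_ip_le_dualNorm ip _ _).trans ?_
    have := dualNorm_nonneg ip (Fs (x ω) (X ω) - F (x ω))
    simp only [Pi.add_apply]
    gcongr
    · nlinarith [sq_nonneg (dualNorm ip (Fs (x ω) (X ω) - F (x ω)) - 1)]
    · exact hpR ω
  exact ⟨hi, hind.integral_comp_prodMk_eq_zero (hx.prodMk hp) hX hm hi fun ω =>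
    (integral_ip_noise (hint _ (hxZ ω)) (h0 _ (hxZ ω)) _).2⟩

/-- The content is the case `σ = 0`, where the quotient is `0`: the oracle is then exact almost
surely at each fixed point, and `lintegral_noise_le` with bound `0` transfers this to the random
point. -/
lemma noise_sq_eq (hFs : Measurable (Function.uncurry Fs)) (hF : Measurable F)
    {x : Ω → E} {X : Ω → Ξ} (hx : Measurable x) (hX : Measurable X) (hxZ : ∀ ω, x ω ∈ Z)
    (hind : IndepFun x X P) (h : ∀ z ∈ Z, σ = 0 → ∀ᵐ ω ∂P, Fs z (X ω) = F z) :
    ∀ᵐ ω ∂P, dualNorm ip (Fs (x ω) (X ω) - F (x ω)) ^ 2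
      = σ ^ 2 * (dualNorm ip (Fs (x ω) (X ω) - F (x ω)) ^ 2 / σ ^ 2) := by
  by_cases hσ : σ = 0
  · have hle := lintegral_noise_le hFs hF hx hX hxZ hind
      (φ := fun n => ‖n‖ₑ) measurable_enorm (B := 0) fun z hz => by
        refine (lintegral_eq_zero_of_ae_eq_zero ?_).le
        filter_upwards [h z hz hσ] with ω hω
        simp [hω]
    have := (lintegral_eq_zero_iff (measurable_noise hFs hF hx hX).enorm).1 (le_antisymm hle bot_le)
    filter_upwards [this] with ω hω
    have : Fs (x ω) (X ω) - F (x ω) = 0 := by simpa using hω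
    rw [this]
    simp [dualNorm]
  · refine Filter.Eventually.of_forall fun ω => ?_
    field_simp

/-- The exponential moments of the noise in a fixed direction. -/
lemma lintegral_exp_noise_le (hFs : Measurable (Function.uncurry Fs)) {X : Ω → Ξ}
    (hX : Measurable X) {z q : E} (hq : ‖q‖ ≤ R)
    (hint : Integrable (fun ω => Fs z (X ω)) P) (h0 : ∫ ω, Fs z (X ω) ∂P = F z)
    (hexp : ∫⁻ ω, ENNReal.ofReal (Real.exp (dualNorm ip (Fs z (X ω) - F z) ^ 2 / σ ^ 2)) ∂P
      ≤ ENNReal.ofReal (Real.exp 1)) (hσ : σ = 0 → ∀ᵐ ω ∂P, Fs z (X ω) = F z) :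
    ∫⁻ ω, ENNReal.ofReal (Real.exp (ip (Fs z (X ω) - F z) q)) ∂P
      ≤ ENNReal.ofReal (Real.exp (σ ^ 2 * R ^ 2)) := by
  have := FiniteDimensional.proper ℝ E
  obtain ⟨i1, i2⟩ := integral_ip_noise (ip := ip) hint h0 q
  have hN : Measurable fun ω => Fs z (X ω) - F z :=
    (hFs.comp (measurable_const.prodMk hX)).sub_const _
  refine lintegral_exp_le_of_sq_le (by positivity) i1 i2
    (Y := fun ω => dualNorm ip (Fs z (X ω) - F z) ^ 2 / σ ^ 2)
    ((((continuous_dualNorm ip).measurable.comp hN).pow_const 2).div_const _).aemeasurable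
    (fun ω => by positivity) ?_ hexp
  have hsq : ∀ᵐ ω ∂P, dualNorm ip (Fs z (X ω) - F z) ^ 2
      = σ ^ 2 * (dualNorm ip (Fs z (X ω) - F z) ^ 2 / σ ^ 2) := by
    by_cases h : σ = 0
    · filter_upwards [hσ h] with ω hω
      simp [hω, dualNorm]
    · refine Filter.Eventually.of_forall fun ω => ?_
      field_simp
  filter_upwards [hsq] with ω hω
  calc ip (Fs z (X ω) - F z) q ^ 2 ≤ (dualNorm ip (Fs z (X ω) - F z) * ‖q‖) ^ 2 :=
        sq_le_sq' (neg_le_of_abs_le (abs_ip_le_dualNorm ip _ _)) (ip_le_dualNorm ip _ _)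
    _ ≤ (dualNorm ip (Fs z (X ω) - F z) * R) ^ 2 := by
        have := dualNorm_nonneg ip (Fs z (X ω) - F z)
        gcongr
    _ = dualNorm ip (Fs z (X ω) - F z) ^ 2 * R ^ 2 := by ring
    _ = σ ^ 2 * (dualNorm ip (Fs z (X ω) - F z) ^ 2 / σ ^ 2) * R ^ 2 := by rw [← hω]
    _ = _ := by ring

/-- The exponential moments of a sum of noise terms in predictable directions. -/
lemma lintegral_exp_sum_noise_le (hFs : Measurable (Function.uncurry Fs)) (hF : Measurable F)
    {𝓕 : ℕ → MeasurableSpace Ω} (h𝓕 : ∀ i, 𝓕 i ≤ 𝓕 (i + 1)) (hle : ∀ i, 𝓕 i ≤ ‹MeasurableSpace Ω›)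
    {x p : ℕ → Ω → E} {X : ℕ → Ω → Ξ} (hx : ∀ i, 1 ≤ i → Measurable[𝓕 i] (x i))
    (hp : ∀ i, 1 ≤ i → Measurable[𝓕 i] (p i))
    (hX : ∀ i, 1 ≤ i → Measurable[𝓕 (i + 1)] (X i))
    (hind : ∀ i, 1 ≤ i → Indep (𝓕 i) (MeasurableSpace.comap (X i) inferInstance) P)
    (hxZ : ∀ i, 1 ≤ i → ∀ ω, x i ω ∈ Z) (hpR : ∀ i, 1 ≤ i → ∀ ω, ‖p i ω‖ ≤ R)
    (hunb : IsUnbiasedOracle P Z F Fs X) (hlight : HasLightTail P ip Z F Fs X σ) (s : ℝ) (t : ℕ) :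
    ∫⁻ ω, ENNReal.ofReal (Real.exp (s * ∑ i ∈ Finset.Icc 1 t,
        i * ip (Fs (x i ω) (X i ω) - F (x i ω)) (p i ω))) ∂P
      ≤ ENNReal.ofReal (Real.exp (s ^ 2 * (σ ^ 2 * R ^ 2 * ∑ i ∈ Finset.Icc 1 t, (i : ℝ) ^ 2))) := by
  have hmono : Monotone 𝓕 := monotone_nat_of_le_succ h𝓕
  induction t with
  | zero => simp
  | succ n ih =>
    have hn : 1 ≤ n + 1 := Nat.le_add_left 1 n
    set S : Ω → ℝ := fun ω => ∑ i ∈ Finset.Icc 1 n,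
      i * ip (Fs (x i ω) (X i ω) - F (x i ω)) (p i ω) with hS
    have hSm : Measurable[𝓕 (n + 1)] S := by
      refine Finset.measurable_fun_sum (m := 𝓕 (n + 1)) _ fun i hi => ?_
      obtain ⟨h1, h2⟩ := Finset.mem_Icc.1 hi
      have l1 : 𝓕 i ≤ 𝓕 (n + 1) := hmono (by omega)
      have l2 : 𝓕 (i + 1) ≤ 𝓕 (n + 1) := hmono (by omega)
      exact (measurable_ip ip (measurable_noise hFs hF ((hx i h1).mono l1 le_rfl)
        ((hX i h1).mono l2 le_rfl)) ((hp i h1).mono l1 le_rfl)).const_mul _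
    -- The query point, the direction and the partial sum are all determined before the last call,
    -- so that call is integrated out with the rest frozen.
    have hU : Measurable[𝓕 (n + 1)] fun ω => (x (n + 1) ω, p (n + 1) ω, S ω) :=
      (hx _ hn).prodMk ((hp _ hn).prodMk hSm)
    have hI := indepFun_of_indep hU (hind _ hn)
    have hf : Measurable fun q : (E × E × ℝ) × Ξ => ENNReal.ofReal (Real.exp (s * q.1.2.2
        + s * ((n + 1 : ℕ) * ip (Fs q.1.1 q.2 - F q.1.1) q.1.2.1))) := by
      have kx : Measurable fun q : (E × E × ℝ) × Ξ => q.1.1 := measurable_fst.comp measurable_fst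
      have kp : Measurable fun q : (E × E × ℝ) × Ξ => q.1.2.1 :=
        measurable_fst.comp (measurable_snd.comp measurable_fst)
      have k := measurable_ip ip (measurable_noise hFs hF kx measurable_snd) kp
      have k2 : Measurable fun q : (E × E × ℝ) × Ξ => q.1.2.2 :=
        measurable_snd.comp (measurable_snd.comp measurable_fst)
      exact (Real.measurable_exp.comp ((k2.const_mul s).add
        ((k.const_mul _).const_mul s))).ennreal_ofReal
    have hXm : Measurable (X (n + 1)) := (hX _ hn).mono (hle _) le_rfl
    have e := hI.lintegral_comp_prodMk (hU.mono (hle _) le_rfl) hXm hf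
    simp only at e
    have e0 : ∀ ω, s * ∑ i ∈ Finset.Icc 1 (n + 1),
        i * ip (Fs (x i ω) (X i ω) - F (x i ω)) (p i ω) = s * S ω
          + s * ((n + 1 : ℕ) * ip (Fs (x (n + 1) ω) (X (n + 1) ω) - F (x (n + 1) ω))
            (p (n + 1) ω)) := fun ω => by
      rw [Finset.sum_Icc_succ_top hn, mul_add]
    simp only [e0]
    rw [e]
    set K := σ ^ 2 * (|s| * (n + 1 : ℕ) * R) ^ 2 with hK
    have hin : ∀ ω, ∫⁻ ω', ENNReal.ofReal (Real.exp (s * S ω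
        + s * ((n + 1 : ℕ) * ip (Fs (x (n + 1) ω) (X (n + 1) ω') - F (x (n + 1) ω))
          (p (n + 1) ω)))) ∂P
        ≤ ENNReal.ofReal (Real.exp (s * S ω)) * ENNReal.ofReal (Real.exp K) := by
      intro ω
      have hz := hxZ _ hn ω
      -- The scalar `s(n+1)` is moved into the direction, so that it only rescales the norm bound.
      have k := lintegral_exp_noise_le (ip := ip) (q := (s * (n + 1 : ℕ)) • p (n + 1) ω)
        (R := |s| * (n + 1 : ℕ) * R) hunb.measurable hXm (by
          rw [norm_smul, Real.norm_eq_abs, abs_mul, Nat.abs_cast]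
          gcongr
          exact hpR _ hn ω) (hunb.integrable _ hn _ hz) (hunb.unbiased _ hn _ hz)
        (hlight _ hn _ hz).1 (hlight _ hn _ hz).2
      calc _ = ∫⁻ ω', ENNReal.ofReal (Real.exp (s * S ω)) * ENNReal.ofReal (Real.exp
            (ip (Fs (x (n + 1) ω) (X (n + 1) ω') - F (x (n + 1) ω))
              ((s * (n + 1 : ℕ)) • p (n + 1) ω))) ∂P := by
            refine lintegral_congr fun ω' => ?_
            rw [Real.exp_add, ENNReal.ofReal_mul (Real.exp_pos _).le, map_smul, smul_eq_mul,
              mul_assoc s]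
        _ ≤ _ := by
            rw [lintegral_const_mul' _ _ ENNReal.ofReal_ne_top]
            gcongr
    calc _ ≤ ∫⁻ ω, ENNReal.ofReal (Real.exp (s * S ω)) * ENNReal.ofReal (Real.exp K) ∂P :=
          lintegral_mono hin
      _ = (∫⁻ ω, ENNReal.ofReal (Real.exp (s * S ω)) ∂P) * ENNReal.ofReal (Real.exp K) :=
          lintegral_mul_const' _ _ ENNReal.ofReal_ne_top
      _ ≤ _ := by
          refine (mul_le_mul_left ih _).trans ?_
          rw [← ENNReal.ofReal_mul (Real.exp_pos _).le, ← Real.exp_add,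
            Finset.sum_Icc_succ_top hn]
          refine le_of_eq ?_
          congr 2
          rw [hK, mul_pow, mul_pow, sq_abs]
          ring

/-- Deviations of a sum of noise terms in predictable directions. -/
lemma measureReal_sum_noise_gt_le (hFs : Measurable (Function.uncurry Fs)) (hF : Measurable F)
    {𝓕 : ℕ → MeasurableSpace Ω} (h𝓕 : ∀ i, 𝓕 i ≤ 𝓕 (i + 1)) (hle : ∀ i, 𝓕 i ≤ ‹MeasurableSpace Ω›)
    {x p : ℕ → Ω → E} {X : ℕ → Ω → Ξ} (hx : ∀ i, 1 ≤ i → Measurable[𝓕 i] (x i))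
    (hp : ∀ i, 1 ≤ i → Measurable[𝓕 i] (p i))
    (hX : ∀ i, 1 ≤ i → Measurable[𝓕 (i + 1)] (X i))
    (hind : ∀ i, 1 ≤ i → Indep (𝓕 i) (MeasurableSpace.comap (X i) inferInstance) P)
    (hxZ : ∀ i, 1 ≤ i → ∀ ω, x i ω ∈ Z) (hpR : ∀ i, 1 ≤ i → ∀ ω, ‖p i ω‖ ≤ R)
    (hunb : IsUnbiasedOracle P Z F Fs X) (hlight : HasLightTail P ip Z F Fs X σ)
    (hσ : 0 ≤ σ) (hR : 0 < R) {t : ℕ} (ht : 1 ≤ t) {lam : ℝ} (hlam : 0 < lam) :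
    P.real {ω | lam * (σ * (R * Real.sqrt (4 / 3 * ∑ i ∈ Finset.Icc 1 t, (i : ℝ) ^ 2)))
        < ∑ i ∈ Finset.Icc 1 t, i * ip (Fs (x i ω) (X i ω) - F (x i ω)) (p i ω)}
      ≤ Real.exp (-lam ^ 2 / 3) := by
  have hNm : ∀ i, 1 ≤ i → Measurable fun ω => Fs (x i ω) (X i ω) - F (x i ω) := fun i hi =>
    measurable_noise hFs hF ((hx i hi).mono (hle _) le_rfl) ((hX i hi).mono (hle _) le_rfl)
  have hSm : Measurable fun ω => ∑ i ∈ Finset.Icc 1 t,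
      i * ip (Fs (x i ω) (X i ω) - F (x i ω)) (p i ω) :=
    Finset.measurable_fun_sum _ fun i hi =>
      (measurable_ip ip (hNm i (Finset.mem_Icc.1 hi).1)
        ((hp i (Finset.mem_Icc.1 hi).1).mono (hle _) le_rfl)).const_mul _
  -- For `σ = 0` the sum vanishes almost surely and the threshold is `0`, so the strict inequality
  -- fails.
  rcases hσ.eq_or_lt with h0 | h0
  · have hae : ∀ᵐ ω ∂P, ∀ i ∈ Finset.Icc 1 t,
        dualNorm ip (Fs (x i ω) (X i ω) - F (x i ω)) ^ 2
          = σ ^ 2 * (dualNorm ip (Fs (x i ω) (X i ω) - F (x i ω)) ^ 2 / σ ^ 2) := by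
      refine (Finset.eventually_all _).2 fun i hi => ?_
      have h1 := (Finset.mem_Icc.1 hi).1
      exact noise_sq_eq hFs hF ((hx i h1).mono (hle _) le_rfl) ((hX i h1).mono (hle _) le_rfl)
        (hxZ i h1) (indepFun_of_indep (hx i h1) (hind i h1))
        fun z hz => (hlight i h1 z hz).2
    have hz : P {ω | lam * (σ * (R * Real.sqrt (4 / 3 * ∑ i ∈ Finset.Icc 1 t, (i : ℝ) ^ 2)))
        < ∑ i ∈ Finset.Icc 1 t, i * ip (Fs (x i ω) (X i ω) - F (x i ω)) (p i ω)} = 0 := by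
      refine measure_eq_zero_iff_ae_notMem.2 ?_
      filter_upwards [hae] with ω hω
      have : ∑ i ∈ Finset.Icc 1 t, i * ip (Fs (x i ω) (X i ω) - F (x i ω)) (p i ω) = 0 := by
        refine Finset.sum_eq_zero fun i hi => ?_
        have k := hω i hi
        rw [← h0] at k
        have k2 : dualNorm ip (Fs (x i ω) (X i ω) - F (x i ω)) = 0 := by simpa using k
        have k3 := abs_ip_le_dualNorm ip (Fs (x i ω) (X i ω) - F (x i ω)) (p i ω)
        rw [k2, zero_mul] at k3
        rw [abs_nonpos_iff.1 k3, mul_zero]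
      change ¬ _ < _
      rw [this, ← h0]
      simp
    rw [measureReal_def, hz]
    simpa using (Real.exp_pos _).le
  · set A := 4 / 3 * ∑ i ∈ Finset.Icc 1 t, (i : ℝ) ^ 2 with hA
    have hA0 : 0 < A := by
      have : (0 : ℝ) < ∑ i ∈ Finset.Icc 1 t, (i : ℝ) ^ 2 :=
        Finset.sum_pos (fun i hi => by
          have : (0 : ℝ) < i := by exact_mod_cast (Finset.mem_Icc.1 hi).1
          positivity) ⟨1, Finset.mem_Icc.2 ⟨le_rfl, ht⟩⟩
      positivity
    set c := σ * (R * Real.sqrt A) with hc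
    have hc0 : 0 < c := by positivity
    have hc2 : c ^ 2 = σ ^ 2 * R ^ 2 * A := by
      rw [hc, mul_pow, mul_pow, Real.sq_sqrt hA0.le]; ring
    -- `s = 2λ/(3c)` minimizes the Chernoff exponent `(3/4) c² s² - λ c s`, with minimum `-λ²/3`;
    -- the factor `4/3` inside `c` is chosen for this exponent.
    have hs : 0 < 2 / 3 * lam / c := by positivity
    have k := lintegral_exp_sum_noise_le hFs hF h𝓕 hle hx hp hX hind hxZ hpR hunb hlight
      (2 / 3 * lam / c) t
    have k2 := measureReal_gt_le_exp (P := P) (a := 2 / 3 * lam / c * (lam * c))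
      (hSm.const_mul (2 / 3 * lam / c)).aemeasurable k
    have e : (2 / 3 * lam / c) ^ 2 * (σ ^ 2 * R ^ 2 * ∑ i ∈ Finset.Icc 1 t, (i : ℝ) ^ 2)
        - 2 / 3 * lam / c * (lam * c) = -lam ^ 2 / 3 := by
      have : σ ^ 2 * R ^ 2 * ∑ i ∈ Finset.Icc 1 t, (i : ℝ) ^ 2 = 3 / 4 * c ^ 2 := by
        rw [hc2, hA]; ring
      rw [this]
      field_simp
      ring
    rw [e] at k2
    refine le_trans (measureReal_mono fun ω hω => ?_) k2
    exact mul_lt_mul_of_pos_left hω hs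

end Oracle

/-! ### Weighted sums of squared noise. -/

section Oracle

variable {E Ω Ξ : Type*} [NormedAddCommGroup E] [NormedSpace ℝ E] [FiniteDimensional ℝ E]
  [MeasurableSpace E] [BorelSpace E] [MeasurableSpace Ω] [MeasurableSpace Ξ] {P : Measure Ω}
  [IsProbabilityMeasure P] {ip : E →L[ℝ] E →L[ℝ] ℝ} {Z : Set E} {F : E → E} {Fs : E → Ξ → E}
  {σ : ℝ}

/-- Deviations of a weighted sum of squared noise terms. -/
lemma measureReal_sum_sq_noise_gt_le (hFs : Measurable (Function.uncurry Fs)) (hF : Measurable F)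
    {x : ℕ → Ω → E} {X : ℕ → Ω → Ξ} (hx : ∀ i, 1 ≤ i → Measurable (x i))
    (hX : ∀ i, 1 ≤ i → Measurable (X i)) (hind : ∀ i, 1 ≤ i → IndepFun (x i) (X i) P)
    (hxZ : ∀ i, 1 ≤ i → ∀ ω, x i ω ∈ Z) (hlight : HasLightTail P ip Z F Fs X σ)
    {b : ℕ → ℝ} (hb : ∀ i, 1 ≤ i → 0 ≤ b i) (t : ℕ) (lam : ℝ) :
    P.real {ω | (1 + lam) * ∑ i ∈ Finset.Icc 1 t, b i * σ ^ 2
        < ∑ i ∈ Finset.Icc 1 t, b i * dualNorm ip (Fs (x i ω) (X i ω) - F (x i ω)) ^ 2}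
      ≤ Real.exp (-lam) := by
  have h1 : ∀ i ∈ Finset.Icc 1 t, 1 ≤ i := fun i hi => (Finset.mem_Icc.1 hi).1
  have hd := (continuous_dualNorm ip).measurable
  have hae : ∀ᵐ ω ∂P, ∀ i ∈ Finset.Icc 1 t,
      dualNorm ip (Fs (x i ω) (X i ω) - F (x i ω)) ^ 2
        = σ ^ 2 * (dualNorm ip (Fs (x i ω) (X i ω) - F (x i ω)) ^ 2 / σ ^ 2) :=
    (Finset.eventually_all _).2 fun i hi => noise_sq_eq hFs hF (hx i (h1 i hi)) (hX i (h1 i hi))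
      (hxZ i (h1 i hi)) (hind i (h1 i hi)) fun z hz => (hlight i (h1 i hi) z hz).2
  have key := measureReal_sum_gt_le (P := P) (Finset.Icc 1 t) (c := fun i => b i * σ ^ 2)
    (Y := fun i ω => dualNorm ip (Fs (x i ω) (X i ω) - F (x i ω)) ^ 2 / σ ^ 2)
    (fun i hi => mul_nonneg (hb i (h1 i hi)) (sq_nonneg _))
    (fun i hi => (((hd.comp (measurable_noise hFs hF (hx i (h1 i hi))
      (hX i (h1 i hi)))).pow_const 2).div_const _).aemeasurable)
    (fun i hi => lintegral_noise_le hFs hF (hx i (h1 i hi)) (hX i (h1 i hi)) (hxZ i (h1 i hi))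
      (hind i (h1 i hi))
      (φ := fun n => ENNReal.ofReal (Real.exp (dualNorm ip n ^ 2 / σ ^ 2)))
      (Real.measurable_exp.comp ((hd.pow_const 2).div_const _)).ennreal_ofReal
      fun z hz => (hlight i (h1 i hi) z hz).1) lam
  refine le_trans (le_of_eq (measureReal_congr ?_)) key
  filter_upwards [hae] with ω hω
  refine propext ?_
  change _ < _ ↔ _ < _
  have : ∑ i ∈ Finset.Icc 1 t, b i * dualNorm ip (Fs (x i ω) (X i ω) - F (x i ω)) ^ 2
      = ∑ i ∈ Finset.Icc 1 t, b i * σ ^ 2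
        * (dualNorm ip (Fs (x i ω) (X i ω) - F (x i ω)) ^ 2 / σ ^ 2) :=
    Finset.sum_congr rfl fun i hi => by rw [mul_assoc, ← hω i hi]
  rw [this]

end Oracle

/-! ### The σ-algebras of past oracle calls. -/

section Past

variable {Ω Ξ : Type*} [MeasurableSpace Ξ]

/-- The σ-algebra generated by the first `a` variables of `ξ` and the first `b` variables of
`ζ`. -/
@[reducible] def pastSigma (ξ ζ : ℕ → Ω → Ξ) (a b : ℕ) : MeasurableSpace Ω :=
  ⨆ i ∈ {i : ℕ ⊕ ℕ | Sum.elim (· < a) (· < b) i},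
    MeasurableSpace.comap (Sum.elim ξ ζ i) inferInstance

variable {ξ ζ : ℕ → Ω → Ξ} {a b : ℕ}

lemma pastSigma_mono {a' b' : ℕ} (ha : a ≤ a') (hb : b ≤ b') :
    pastSigma ξ ζ a b ≤ pastSigma ξ ζ a' b' := by
  refine biSup_mono fun i hi => ?_
  rcases i with i | i
  · exact lt_of_lt_of_le (show i < a from hi) ha
  · exact lt_of_lt_of_le (show i < b from hi) hb

lemma measurable_pastSigma_left {j : ℕ} (hj : j < a) : Measurable[pastSigma ξ ζ a b] (ξ j) :=
  measurable_iff_comap_le.2 (le_biSup (fun i : ℕ ⊕ ℕ =>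
    MeasurableSpace.comap (Sum.elim ξ ζ i) inferInstance) (i := Sum.inl j) hj)

lemma measurable_pastSigma_right {j : ℕ} (hj : j < b) : Measurable[pastSigma ξ ζ a b] (ζ j) :=
  measurable_iff_comap_le.2 (le_biSup (fun i : ℕ ⊕ ℕ =>
    MeasurableSpace.comap (Sum.elim ξ ζ i) inferInstance) (i := Sum.inr j) hj)

variable [mΩ : MeasurableSpace Ω] {P : Measure Ω}

lemma comap_sumElim_le (hξ : ∀ i, Measurable (ξ i)) (hζ : ∀ i, Measurable (ζ i)) (i : ℕ ⊕ ℕ) :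
    MeasurableSpace.comap (Sum.elim ξ ζ i) inferInstance ≤ mΩ := by
  rcases i with i | i
  · exact (hξ i).comap_le
  · exact (hζ i).comap_le

lemma pastSigma_le (hξ : ∀ i, Measurable (ξ i)) (hζ : ∀ i, Measurable (ζ i)) :
    pastSigma ξ ζ a b ≤ mΩ :=
  iSup₂_le fun i _ => comap_sumElim_le hξ hζ i

/-- Disjoint subfamilies of mutually independent variables generate independent σ-algebras. -/
lemma indep_pastSigma (hξ : ∀ i, Measurable (ξ i)) (hζ : ∀ i, Measurable (ζ i))
    (hindep : iIndepFun (Sum.elim ξ ζ) P) {j : ℕ ⊕ ℕ} (hj : ¬ Sum.elim (· < a) (· < b) j) :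
    Indep (pastSigma ξ ζ a b) (MeasurableSpace.comap (Sum.elim ξ ζ j) inferInstance) P := by
  have h := (iIndepFun_iff_iIndep _ _ _).1 hindep
  have hd : Disjoint {i : ℕ ⊕ ℕ | Sum.elim (· < a) (· < b) i} {j} :=
    Set.disjoint_singleton_right.2 hj
  have := indep_iSup_of_disjoint (comap_sumElim_le hξ hζ) h hd
  rwa [iSup_singleton] at this

lemma indep_pastSigma_left (hξ : ∀ i, Measurable (ξ i)) (hζ : ∀ i, Measurable (ζ i))
    (hindep : iIndepFun (Sum.elim ξ ζ) P) {j : ℕ} (hj : a ≤ j) :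
    Indep (pastSigma ξ ζ a b) (MeasurableSpace.comap (ξ j) inferInstance) P :=
  indep_pastSigma hξ hζ hindep (j := Sum.inl j) (not_lt.2 hj)

lemma indep_pastSigma_right (hξ : ∀ i, Measurable (ξ i)) (hζ : ∀ i, Measurable (ζ i))
    (hindep : iIndepFun (Sum.elim ξ ζ) P) {j : ℕ} (hj : b ≤ j) :
    Indep (pastSigma ξ ζ a b) (MeasurableSpace.comap (ζ j) inferInstance) P :=
  indep_pastSigma hξ hζ hindep (j := Sum.inr j) (not_lt.2 hj)

end Past

/-! ### The constants of the final bounds. -/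

section Constants

variable {μ LG LH σG σH ΩZ : ℝ}

/-- The factor `13/6 = 2/3 + 3/2` collects the coefficients of the two `H`-noises. The total noise
constant is `2√2 + (13/6)(4√2/3) = 44√2/9 < 7`. -/
lemma le_ampC0 (hμ : 0 < μ) (hLG : 0 ≤ LG) (hLH : 0 ≤ LH) (hσG : 0 ≤ σG) (hσH : 0 ≤ σH)
    (hΩ : 0 < ΩZ) {t : ℕ} (ht : 2 ≤ t) :
    2 / (t * ((t : ℝ) + 1)) * (2 * (t / ampGamma μ LG LH σG σH ΩZ t) * ΩZ ^ 2
      + 13 / 6 * ∑ i ∈ Finset.Icc 1 t,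
        (i * ampGamma μ LG LH σG σH ΩZ i / μ * (σH ^ 2 + σG ^ 2)))
      ≤ ampC0 μ LG LH σG σH ΩZ t := by
  have h1 := div_ampGamma_mul_le (LG := LG) (LH := LH) (σG := σG) (σH := σH) hμ hΩ ht
  have h2 := sum_ampGamma_le (σG := σG) (σH := σH) hμ hLG hLH hΩ ht
  have h3 : Real.sqrt (σH ^ 2 + σG ^ 2) * ΩZ / Real.sqrt (μ * (t - 1))
      ≤ (σG + σH) * ΩZ / Real.sqrt (μ * (t - 1)) := by
    gcongr
    exact sqrt_add_sq_le hσG hσH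
  have h4 : 0 ≤ Real.sqrt (σH ^ 2 + σG ^ 2) * ΩZ / Real.sqrt (μ * (t - 1)) := by positivity
  unfold ampC0
  have e : 7 * (σG + σH) * ΩZ / Real.sqrt (μ * (t - 1))
      = 7 * ((σG + σH) * ΩZ / Real.sqrt (μ * (t - 1))) := by ring
  rw [e, mul_add]
  have h5 := mul_le_mul_of_nonneg_right sqrt_two_le h4
  linarith

/-- The squared noises contribute `(13/6)(4√2/3)` and the paired noises `4√2/3`, in total `38√2/9 <
6`. -/
lemma le_ampC1 (hμ : 0 < μ) (hLG : 0 ≤ LG) (hLH : 0 ≤ LH) (hσG : 0 ≤ σG) (hσH : 0 ≤ σH)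
    (hΩ : 0 < ΩZ) {t : ℕ} (ht : 2 ≤ t) :
    2 / (t * ((t : ℝ) + 1)) * (13 / 6 * ∑ i ∈ Finset.Icc 1 t,
        (i * ampGamma μ LG LH σG σH ΩZ i / μ * (σH ^ 2 + σG ^ 2))
      + (σG + σH) * (Real.sqrt (2 * ΩZ ^ 2 / μ)
        * Real.sqrt (4 / 3 * ∑ i ∈ Finset.Icc 1 t, (i : ℝ) ^ 2)))
      ≤ ampC1 μ σG σH ΩZ t := by
  have ht0 : (2 : ℝ) ≤ t := by exact_mod_cast ht
  have htp : (0 : ℝ) < t := by linarith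
  have htm : (0 : ℝ) < t - 1 := by linarith
  have h2 := sum_ampGamma_le (σG := σG) (σH := σH) hμ hLG hLH hΩ ht
  have h3 : Real.sqrt (σH ^ 2 + σG ^ 2) * ΩZ / Real.sqrt (μ * (t - 1))
      ≤ (σG + σH) * ΩZ / Real.sqrt (μ * (t - 1)) := by
    gcongr
    exact sqrt_add_sq_le hσG hσH
  have hsum : ∀ n : ℕ, ∑ i ∈ Finset.Icc 1 n, (i : ℝ) ^ 2
      = n * ((n : ℝ) + 1) * (2 * n + 1) / 6 := by
    intro n
    induction n with
    | zero => simp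
    | succ n ih =>
      rw [Finset.sum_Icc_succ_top (by omega), ih]
      push_cast
      ring
  -- By the formula for the sum of squares, this reduces to `2t + 1 ≤ 2(t + 1)`.
  have h6 : Real.sqrt (4 / 3 * ∑ i ∈ Finset.Icc 1 t, (i : ℝ) ^ 2)
      ≤ 2 / 3 * ((t : ℝ) + 1) * Real.sqrt t := by
    refine Real.sqrt_le_iff.2 ⟨by positivity, ?_⟩
    rw [mul_pow, Real.sq_sqrt htp.le, hsum]
    nlinarith [mul_pos htp (by linarith : (0 : ℝ) < t + 1)]
  have h7 : 2 / (t * ((t : ℝ) + 1)) * ((σG + σH) * (Real.sqrt (2 * ΩZ ^ 2 / μ)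
        * Real.sqrt (4 / 3 * ∑ i ∈ Finset.Icc 1 t, (i : ℝ) ^ 2)))
      ≤ 4 * Real.sqrt 2 / 3 * ((σG + σH) * ΩZ / Real.sqrt (μ * (t - 1))) := by
    have hst : 0 < Real.sqrt t := Real.sqrt_pos.2 htp
    have hsμ : 0 < Real.sqrt μ := Real.sqrt_pos.2 hμ
    have hst2 := Real.sq_sqrt htp.le
    calc _ ≤ 2 / (t * ((t : ℝ) + 1)) * ((σG + σH) * (Real.sqrt (2 * ΩZ ^ 2 / μ)
          * (2 / 3 * ((t : ℝ) + 1) * Real.sqrt t))) := by gcongr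
      _ = 4 * Real.sqrt 2 / 3 * ((σG + σH) * ΩZ / Real.sqrt (μ * t)) := by
          rw [Real.sqrt_div (by positivity), Real.sqrt_mul (by norm_num), Real.sqrt_sq hΩ.le,
            Real.sqrt_mul hμ.le]
          field_simp
          rw [hst2]
          ring
      _ ≤ _ := by
          have : 0 < Real.sqrt (μ * (t - 1)) := Real.sqrt_pos.2 (by positivity)
          have : Real.sqrt (μ * (t - 1)) ≤ Real.sqrt (μ * t) :=
            Real.sqrt_le_sqrt (by nlinarith)
          gcongr
  have h4 : 0 ≤ (σG + σH) * ΩZ / Real.sqrt (μ * (t - 1)) := by positivity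
  unfold ampC1
  have e : 6 * (σG + σH) * ΩZ / Real.sqrt (μ * (t - 1))
      = 6 * ((σG + σH) * ΩZ / Real.sqrt (μ * (t - 1))) := by ring
  rw [e, mul_add]
  have h5 := mul_le_mul_of_nonneg_right sqrt_two_le h4
  have h8 := mul_le_mul_of_nonneg_left h3 (by positivity : 0 ≤ 4 * Real.sqrt 2 / 3)
  linarith

end Constants

/-! ### Auxiliary processes and the pathwise bound. -/

/-- The processes `p` (the second prox-steps taken with the exact value of the operator) and `v`
(mirror descent on the noise) accompanying stochastic AMP; all processes stay in `Z` and are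
predictable. -/
structure IsAuxiliary {E Ω Ξ : Type*} [NormedAddCommGroup E] [NormedSpace ℝ E]
    [MeasurableSpace E] [MeasurableSpace Ξ] (ip : E →L[ℝ] E →L[ℝ] ℝ) (Z : Set E) (dgf : E → ℝ)
    (gradDgf : E → E) (gradG H : E → E) (J : E → ℝ) (Gs Hs : E → Ξ → E) (ξ ζ : ℕ → Ω → Ξ)
    (γ : ℕ → ℝ) (r w wag wmd p v : ℕ → Ω → E) : Prop where
  r_mem : ∀ t, 1 ≤ t → ∀ ω, r t ω ∈ Z
  w_mem : ∀ t, 1 ≤ t → ∀ ω, w (t + 1) ω ∈ Z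
  wag_mem : ∀ t, 1 ≤ t → ∀ ω, wag t ω ∈ Z
  wmd_mem : ∀ t, 1 ≤ t → ∀ ω, wmd t ω ∈ Z
  p_mem : ∀ t, 1 ≤ t → ∀ ω, p t ω ∈ Z
  v_mem : ∀ t, 1 ≤ t → ∀ ω, v t ω ∈ Z
  measurable_r : ∀ t, 1 ≤ t → Measurable[pastSigma ξ ζ t (2 * t - 1)] (r t)
  measurable_wag : ∀ t, 1 ≤ t → Measurable[pastSigma ξ ζ t (2 * t - 1)] (wag t)
  measurable_wmd : ∀ t, 1 ≤ t → Measurable[pastSigma ξ ζ t (2 * t - 1)] (wmd t)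
  measurable_v : ∀ t, 1 ≤ t → Measurable[pastSigma ξ ζ t (2 * t - 1)] (v t)
  measurable_w : ∀ t, 1 ≤ t → Measurable[pastSigma ξ ζ (t + 1) (2 * t)] (w (t + 1))
  measurable_p : ∀ t, 1 ≤ t → Measurable[pastSigma ξ ζ (t + 1) (2 * t)] (p t)
  step_p : ∀ t, 1 ≤ t → ∀ ω, IsProx ip Z dgf gradDgf (fun u => γ t * J u) (r t ω)
    (γ t • H (w (t + 1) ω) + γ t • Gs (wmd t ω) (ξ t ω)) (p t ω)
  step_v : ∀ t, 1 ≤ t → ∀ ω, IsProx ip Z dgf gradDgf (fun _ => 0) (v t ω)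
    ((-γ t) • ((Hs (w (t + 1) ω) (ζ (2 * t) ω) - H (w (t + 1) ω))
      + (Gs (wmd t ω) (ξ t ω) - gradG (wmd t ω)))) (v (t + 1) ω)

/-- The pathwise bound on the gap function. -/
lemma IsAuxiliary.viGap_le {E Ω Ξ : Type*} [NormedAddCommGroup E] [NormedSpace ℝ E]
    [MeasurableSpace E] [MeasurableSpace Ξ] {ip : E →L[ℝ] E →L[ℝ] ℝ} {Z : Set E} {μ : ℝ}
    {dgf : E → ℝ} {gradDgf : E → E} {G : E → ℝ} {gradG H : E → E} {J : E → ℝ} {LG LH : ℝ}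
    {Gs Hs : E → Ξ → E} {ξ ζ : ℕ → Ω → Ξ} {γ : ℕ → ℝ} {r₁ : E} {r w wag wmd p v : ℕ → Ω → E}
    {σG σH ΩZ : ℝ} (hVI : IsVIProblem ip Z G gradG H J LG LH)
    (hdgf : IsDistanceGenerating ip Z μ dgf gradDgf) (hΩ : 0 < ΩZ)
    (hV : ∀ z₁ ∈ Z, ∀ z₂ ∈ Z, bregman ip dgf gradDgf z₁ z₂ ≤ ΩZ ^ 2)
    (hσG : 0 ≤ σG) (hσH : 0 ≤ σH) (hpos : 0 < LG + LH + σG + σH)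
    (hγ : γ = ampGamma μ LG LH σG σH ΩZ)
    (hAMP : IsStochasticAMP ip Z dgf gradDgf J Gs Hs ξ ζ ampAlpha γ r₁ r w wag wmd)
    (haux : IsAuxiliary ip Z dgf gradDgf gradG H J Gs Hs ξ ζ γ r w wag wmd p v)
    {t : ℕ} (ht : 1 ≤ t) (ω : Ω) :
    viGap ip Z G H J (wag (t + 1) ω) ≤ 2 / (t * ((t : ℝ) + 1)) * (2 * (t / γ t) * ΩZ ^ 2
      + (∑ i ∈ Finset.Icc 1 t, 2 / 3 * (i * γ i / μ)
          * dualNorm ip (Hs (r i ω) (ζ (2 * i - 1) ω) - H (r i ω)) ^ 2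
        + ∑ i ∈ Finset.Icc 1 t, 3 / 2 * (i * γ i / μ)
          * dualNorm ip (Hs (w (i + 1) ω) (ζ (2 * i) ω) - H (w (i + 1) ω)) ^ 2
        + ∑ i ∈ Finset.Icc 1 t, 2 * (i * γ i / μ)
          * dualNorm ip (Gs (wmd i ω) (ξ i ω) - gradG (wmd i ω)) ^ 2
        + ∑ i ∈ Finset.Icc 1 t, i * ip (Gs (wmd i ω) (ξ i ω) - gradG (wmd i ω)) (v i ω - r i ω)
        + ∑ i ∈ Finset.Icc 1 t, i * ip (Hs (w (i + 1) ω) (ζ (2 * i) ω) - H (w (i + 1) ω))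
            (v i ω - p i ω))) := by
  have hγ0 : 0 < γ t := hγ ▸ ampGamma_pos hdgf.mu_pos hVI.LG_nonneg hVI.LH_nonneg hσG hσH hΩ
    hpos ht
  have h1 : 1 ≤ t + 1 := by omega
  refine viGap_le_of_viQ_le hVI.nonempty ht (C := t / γ t) (by positivity)
    (fun u hu => add_nonneg (hdgf.bregman_nonneg (haux.r_mem _ h1 ω) hu)
      (hdgf.bregman_nonneg (haux.v_mem _ h1 ω) hu)) fun u hu => ?_
  refine (viQ_recursion hVI hdgf hΩ hV hσG hσH hpos hγ
    (r := fun t => r t ω) (w := fun t => w t ω) (p := fun t => p t ω) (v := fun t => v t ω)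
    (wag := fun t => wag t ω) (md := fun t => wmd t ω) (g := fun t => Gs (wmd t ω) (ξ t ω))
    (a := fun t => Hs (r t ω) (ζ (2 * t - 1) ω))
    (b := fun t => Hs (w (t + 1) ω) (ζ (2 * t) ω))
    (fun t ht => haux.r_mem t ht ω) (fun t ht => haux.v_mem t ht ω)
    (fun t ht => haux.wag_mem t ht ω) (fun t ht => hAMP.step_wmd t ht ω)
    (fun t ht => hAMP.step_wag t ht ω) (fun t ht => hAMP.step_w t ht ω)
    (fun t ht => hAMP.step_r t ht ω) (fun t ht => haux.step_p t ht ω)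
    (fun t ht => haux.step_v t ht ω) hu t).trans (le_of_eq ?_)
  simp only [← Finset.sum_add_distrib]
  congr 1
  refine Finset.sum_congr rfl fun i _ => ?_
  ring

section Processes

variable {E Ω Ξ : Type*} [NormedAddCommGroup E] [NormedSpace ℝ E] [FiniteDimensional ℝ E]
  [MeasurableSpace E] [BorelSpace E] [MeasurableSpace Ξ]
  {ip : E →L[ℝ] E →L[ℝ] ℝ} {Z : Set E} {μ : ℝ} {dgf : E → ℝ} {gradDgf : E → E}
  {G : E → ℝ} {gradG H : E → E} {J : E → ℝ} {LG LH : ℝ} {Gs Hs : E → Ξ → E}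
  {ξ ζ : ℕ → Ω → Ξ} {γ : ℕ → ℝ} {r₁ : E} {r w wag wmd p v : ℕ → Ω → E}

lemma measurable_oracle_combination {m : MeasurableSpace Ω} {A B : E → Ξ → E}
    (hA : Measurable (Function.uncurry A)) (hB : Measurable (Function.uncurry B))
    {x y : Ω → E} {X Y : Ω → Ξ} (hx : Measurable x) (hX : Measurable X) (hy : Measurable y)
    (hY : Measurable Y) (c : ℝ) :
    Measurable fun ω => c • A (x ω) (X ω) + c • B (y ω) (Y ω) := by
  have := FiniteDimensional.proper ℝ E
  exact ((hA.comp (hx.prodMk hX)).const_smul c).add ((hB.comp (hy.prodMk hY)).const_smul c)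

/-- Prox points in `Z` are unique and given by measurable maps. Hence `p` and `v` can be defined by
recursion, and the given iterates, assumed only to satisfy the prox conditions, are measurable
functions of the past calls. -/
lemma exists_isAuxiliary (hVI : IsVIProblem ip Z G gradG H J LG LH)
    (hdgf : IsDistanceGenerating ip Z μ dgf gradDgf) (hZ : IsCompact Z)
    (hgradG : Measurable gradG) (hH : Measurable H) (hGs : Measurable (Function.uncurry Gs))
    (hHs : Measurable (Function.uncurry Hs)) (hγ : ∀ t, 1 ≤ t → 0 ≤ γ t)
    (hAMP : IsStochasticAMP ip Z dgf gradDgf J Gs Hs ξ ζ ampAlpha γ r₁ r w wag wmd) :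
    ∃ p v : ℕ → Ω → E,
      IsAuxiliary ip Z dgf gradDgf gradG H J Gs Hs ξ ζ γ r w wag wmd p v := by
  have := FiniteDimensional.proper ℝ E
  have hne := hVI.nonempty
  -- the prox-mappings
  have hpr : ∀ t : ℕ, ∃ pr : E → E → E, Measurable (Function.uncurry pr) ∧ (1 ≤ t →
      ∀ z ∈ Z, ∀ η w, IsProx ip Z dgf gradDgf (fun u => γ t * J u) z η w ↔ w = pr z η) := by
    intro t
    by_cases ht : 1 ≤ t
    · have hJ : ConvexOn ℝ Z (fun u => γ t * J u) := by
        simpa [smul_eq_mul] using hVI.convexJ.smul (hγ t ht)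
      have hl : LowerSemicontinuousOn (fun u => γ t * J u) Z :=
        (continuous_const_mul (γ t)).comp_lowerSemicontinuousOn hVI.lscJ
          fun a b hab => mul_le_mul_of_nonneg_left hab (hγ t ht)
      obtain ⟨pr, h1, h2⟩ := hdgf.exists_measurable_prox hZ hne hJ hl
      exact ⟨pr, h1, fun _ => h2⟩
    · exact ⟨fun _ _ => 0, measurable_const, fun h => absurd h ht⟩
  choose pr hprm hpr using hpr
  obtain ⟨pr₀, hpr₀m, hpr₀⟩ := hdgf.exists_measurable_prox hZ hne
    (convexOn_const 0 hVI.convex) continuousOn_const.lowerSemicontinuousOn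
  -- The recursion proper starts at index `1`; the value at `0` is a dummy.
  let v : ℕ → Ω → E := fun t => Nat.rec (fun _ => r₁) (fun t vt ω => if t = 0 then r₁ else
    pr₀ (vt ω) ((-γ t) • ((Hs (w (t + 1) ω) (ζ (2 * t) ω) - H (w (t + 1) ω))
      + (Gs (wmd t ω) (ξ t ω) - gradG (wmd t ω))))) t
  have hv1 : v 1 = fun _ => r₁ := rfl
  have hvs : ∀ t, 1 ≤ t → v (t + 1) = fun ω =>
      pr₀ (v t ω) ((-γ t) • ((Hs (w (t + 1) ω) (ζ (2 * t) ω) - H (w (t + 1) ω))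
      + (Gs (wmd t ω) (ξ t ω) - gradG (wmd t ω)))) := by
    intro t ht
    funext ω
    simp only [v]
    rw [if_neg (by omega)]
  let p : ℕ → Ω → E := fun t ω =>
    pr t (r t ω) (γ t • H (w (t + 1) ω) + γ t • Gs (wmd t ω) (ξ t ω))
  have hw_mem : ∀ t, 1 ≤ t → ∀ ω, w (t + 1) ω ∈ Z := fun t ht ω => (hAMP.step_w t ht ω).1
  have hr_mem : ∀ t, 1 ≤ t → ∀ ω, r t ω ∈ Z := by
    intro t ht ω
    obtain ⟨s, rfl⟩ : ∃ s, t = s + 1 := ⟨t - 1, by omega⟩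
    rcases Nat.eq_zero_or_pos s with rfl | hs
    · rw [hAMP.init_r]; exact hAMP.init_mem
    · exact (hAMP.step_r s hs ω).1
  have hwag_mem : ∀ t, 1 ≤ t → ∀ ω, wag t ω ∈ Z := by
    intro t ht ω
    induction t, ht using Nat.le_induction with
    | base => rw [hAMP.init_wag]; exact hAMP.init_mem
    | succ t ht ih =>
      rw [hAMP.step_wag t ht ω]
      exact hVI.convex ih (hw_mem t ht ω) (sub_nonneg.2 (ampAlpha_mem ht).2)
        (ampAlpha_mem ht).1 (by ring)
  have hwmd_mem : ∀ t, 1 ≤ t → ∀ ω, wmd t ω ∈ Z := by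
    intro t ht ω
    rw [hAMP.step_wmd t ht ω]
    exact hVI.convex (hwag_mem t ht ω) (hr_mem t ht ω) (sub_nonneg.2 (ampAlpha_mem ht).2)
      (ampAlpha_mem ht).1 (by ring)
  have hp_prox : ∀ t, 1 ≤ t → ∀ ω, IsProx ip Z dgf gradDgf (fun u => γ t * J u) (r t ω)
      (γ t • H (w (t + 1) ω) + γ t • Gs (wmd t ω) (ξ t ω)) (p t ω) := fun t ht ω =>
    (hpr t ht _ (hr_mem t ht ω) _ _).2 rfl
  have hv_mem : ∀ t, 1 ≤ t → ∀ ω, v t ω ∈ Z := by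
    intro t ht ω
    induction t, ht using Nat.le_induction with
    | base => exact hAMP.init_mem
    | succ t ht ih =>
      rw [hvs t ht]
      exact ((hpr₀ _ ih _ _).2 rfl).1
  have hv_prox : ∀ t, 1 ≤ t → ∀ ω, IsProx ip Z dgf gradDgf (fun _ => 0) (v t ω)
      ((-γ t) • ((Hs (w (t + 1) ω) (ζ (2 * t) ω) - H (w (t + 1) ω))
      + (Gs (wmd t ω) (ξ t ω) - gradG (wmd t ω)))) (v (t + 1) ω) := fun t ht ω => by
    rw [hvs t ht]
    exact (hpr₀ _ (hv_mem t ht ω) _ _).2 rfl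
  -- measurability of one step
  have mwmd : ∀ t, 1 ≤ t → Measurable[pastSigma ξ ζ t (2 * t - 1)] (r t) →
      Measurable[pastSigma ξ ζ t (2 * t - 1)] (wag t) →
      Measurable[pastSigma ξ ζ t (2 * t - 1)] (wmd t) := by
    intro t ht hr hwag
    rw [funext (hAMP.step_wmd t ht)]
    exact (hwag.const_smul _).add (hr.const_smul _)
  have mw : ∀ t, 1 ≤ t → Measurable[pastSigma ξ ζ t (2 * t - 1)] (r t) →
      Measurable[pastSigma ξ ζ t (2 * t - 1)] (wag t) →
      Measurable[pastSigma ξ ζ (t + 1) (2 * t)] (w (t + 1)) := by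
    intro t ht hr hwag
    -- `w (t + 1)` uses the new variables `ζ (2t - 1)` and `ξ t`, but not `ζ (2t)`.
    have l : pastSigma ξ ζ t (2 * t - 1) ≤ pastSigma ξ ζ (t + 1) (2 * t) :=
      pastSigma_mono (by omega) (by omega)
    rw [funext fun ω => (hpr t ht _ (hr_mem t ht ω) _ _).1 (hAMP.step_w t ht ω)]
    exact (hprm t).comp ((hr.mono l le_rfl).prodMk (measurable_oracle_combination hHs hGs
      (hr.mono l le_rfl) (measurable_pastSigma_right (by omega))
      ((mwmd t ht hr hwag).mono l le_rfl) (measurable_pastSigma_left (by omega)) _))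
  have mall : ∀ t, 1 ≤ t → Measurable[pastSigma ξ ζ t (2 * t - 1)] (r t) ∧
      Measurable[pastSigma ξ ζ t (2 * t - 1)] (wag t) ∧
      Measurable[pastSigma ξ ζ t (2 * t - 1)] (v t) := by
    intro t ht
    induction t, ht using Nat.le_induction with
    | base =>
      rw [funext hAMP.init_r, funext hAMP.init_wag, hv1]
      exact ⟨measurable_const, measurable_const, measurable_const⟩
    | succ t ht ih =>
      obtain ⟨hr, hwag, hv⟩ := ih
      have l : pastSigma ξ ζ t (2 * t - 1) ≤ pastSigma ξ ζ (t + 1) (2 * (t + 1) - 1) :=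
        pastSigma_mono (by omega) (by omega)
      have l' : pastSigma ξ ζ (t + 1) (2 * t) ≤ pastSigma ξ ζ (t + 1) (2 * (t + 1) - 1) :=
        pastSigma_mono (by omega) (by omega)
      have kw := (mw t ht hr hwag).mono l' le_rfl
      have kmd := (mwmd t ht hr hwag).mono l le_rfl
      have kζ : Measurable[pastSigma ξ ζ (t + 1) (2 * (t + 1) - 1)] (ζ (2 * t)) :=
        measurable_pastSigma_right (by omega)
      have kξ : Measurable[pastSigma ξ ζ (t + 1) (2 * (t + 1) - 1)] (ξ t) :=
        measurable_pastSigma_left (by omega)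
      refine ⟨?_, ?_, ?_⟩
      · rw [funext fun ω => (hpr t ht _ (hr_mem t ht ω) _ _).1 (hAMP.step_r t ht ω)]
        exact (hprm t).comp ((hr.mono l le_rfl).prodMk
          (measurable_oracle_combination hHs hGs kw kζ kmd kξ _))
      · rw [funext (hAMP.step_wag t ht)]
        exact ((hwag.mono l le_rfl).const_smul _).add (kw.const_smul _)
      · rw [hvs t ht]
        exact hpr₀m.comp ((hv.mono l le_rfl).prodMk
          (((measurable_noise hHs hH kw kζ).add
            (measurable_noise hGs hgradG kmd kξ)).const_smul _))
  refine ⟨p, v, ?_⟩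
  exact
    { r_mem := hr_mem
      w_mem := hw_mem
      wag_mem := hwag_mem
      wmd_mem := hwmd_mem
      p_mem := fun t ht ω => (hp_prox t ht ω).1
      v_mem := hv_mem
      measurable_r := fun t ht => (mall t ht).1
      measurable_wag := fun t ht => (mall t ht).2.1
      measurable_wmd := fun t ht => mwmd t ht (mall t ht).1 (mall t ht).2.1
      measurable_v := fun t ht => (mall t ht).2.2
      measurable_w := fun t ht => mw t ht (mall t ht).1 (mall t ht).2.1
      -- `p t` avoids `ζ (2t)` because it uses the exact value of `H`; this is the reason for
      -- introducing it.
      measurable_p := fun t ht => by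
        have l : pastSigma ξ ζ t (2 * t - 1) ≤ pastSigma ξ ζ (t + 1) (2 * t) :=
          pastSigma_mono (by omega) (by omega)
        have kw := mw t ht (mall t ht).1 (mall t ht).2.1
        have kmd := (mwmd t ht (mall t ht).1 (mall t ht).2.1).mono l le_rfl
        have kξ : Measurable[pastSigma ξ ζ (t + 1) (2 * t)] (ξ t) :=
          measurable_pastSigma_left (by omega)
        have kHw := hH.comp kw
        exact (hprm t).comp (((mall t ht).1.mono l le_rfl).prodMk ((kHw.const_smul _).add
          ((hGs.comp (kmd.prodMk kξ)).const_smul _)))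
      step_p := hp_prox
      step_v := hv_prox }

end Processes

lemma IsUnbiasedOracle.comp {E Ω Ξ : Type*} [NormedAddCommGroup E] [NormedSpace ℝ E]
    [MeasurableSpace E] [MeasurableSpace Ω] [MeasurableSpace Ξ] {P : Measure Ω} {Z : Set E}
    {F : E → E} {Fs : E → Ξ → E} {ξ : ℕ → Ω → Ξ} (h : IsUnbiasedOracle P Z F Fs ξ)
    {k : ℕ → ℕ} (hk : ∀ i, 1 ≤ i → 1 ≤ k i) :
    IsUnbiasedOracle P Z F Fs fun i => ξ (k i) :=
  ⟨h.measurable, fun i hi => h.integrable _ (hk i hi), fun i hi => h.unbiased _ (hk i hi)⟩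

lemma IsUnbiasedOracle.congr {E Ω Ξ : Type*} [NormedAddCommGroup E] [NormedSpace ℝ E]
    [MeasurableSpace E] [MeasurableSpace Ω] [MeasurableSpace Ξ] {P : Measure Ω} {Z : Set E}
    {F F' : E → E} {Fs : E → Ξ → E} {ξ : ℕ → Ω → Ξ} (h : IsUnbiasedOracle P Z F Fs ξ)
    (hF : ∀ x ∈ Z, F' x = F x) : IsUnbiasedOracle P Z F' Fs ξ :=
  ⟨h.measurable, h.integrable, fun i hi x hx => (h.unbiased i hi x hx).trans (hF x hx).symm⟩

/-! ### Expectation and deviation bounds. -/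

section Bounds

variable {E Ω Ξ : Type*} [NormedAddCommGroup E] [NormedSpace ℝ E] [FiniteDimensional ℝ E]
  [MeasurableSpace E] [BorelSpace E] [mΩ : MeasurableSpace Ω] [MeasurableSpace Ξ]
  {P : Measure Ω} [IsProbabilityMeasure P]
  {ip : E →L[ℝ] E →L[ℝ] ℝ} {Z : Set E} {μ : ℝ} {dgf : E → ℝ} {gradDgf : E → E}
  {G : E → ℝ} {gradG H : E → E} {J : E → ℝ} {LG LH : ℝ} {Gs Hs : E → Ξ → E}
  {ξ ζ : ℕ → Ω → Ξ} {γ : ℕ → ℝ} {r₁ : E} {r w wag wmd p v : ℕ → Ω → E} {σG σH ΩZ : ℝ}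

/-- The bound on the expected gap. -/
lemma IsAuxiliary.integral_viGap_le (hVI : IsVIProblem ip Z G gradG H J LG LH)
    (hdgf : IsDistanceGenerating ip Z μ dgf gradDgf) (hΩ : 0 < ΩZ)
    (hV : ∀ z₁ ∈ Z, ∀ z₂ ∈ Z, bregman ip dgf gradDgf z₁ z₂ ≤ ΩZ ^ 2)
    (hξ : ∀ i, Measurable (ξ i)) (hζ : ∀ i, Measurable (ζ i))
    (hindep : iIndepFun (Sum.elim ξ ζ) P)
    (hGs : IsUnbiasedOracle P Z gradG Gs ξ) (hHs : IsUnbiasedOracle P Z H Hs ζ)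
    (hgradG : Measurable gradG) (hH : Measurable H)
    (hσG : 0 ≤ σG) (hσH : 0 ≤ σH) (hpos : 0 < LG + LH + σG + σH)
    (hγ : γ = ampGamma μ LG LH σG σH ΩZ)
    (hAMP : IsStochasticAMP ip Z dgf gradDgf J Gs Hs ξ ζ ampAlpha γ r₁ r w wag wmd)
    (haux : IsAuxiliary ip Z dgf gradDgf gradG H J Gs Hs ξ ζ γ r w wag wmd p v)
    (hvG : HasBoundedVariance P ip Z gradG Gs ξ σG) (hvH : HasBoundedVariance P ip Z H Hs ζ σH)
    {t : ℕ} (ht : 2 ≤ t) :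
    Integrable (fun ω => viGap ip Z G H J (wag (t + 1) ω)) P ∧
      ∫ ω, viGap ip Z G H J (wag (t + 1) ω) ∂P ≤ ampC0 μ LG LH σG σH ΩZ t := by
  have hZ := isCompact_of_bregman_le hVI.isClosed hdgf hV
  have hμ := hdgf.mu_pos
  have hle : ∀ a b, pastSigma ξ ζ a b ≤ mΩ := fun a b => pastSigma_le hξ hζ
  have mem1 : ∀ {i}, i ∈ Finset.Icc 1 t → 1 ≤ i := fun hi => (Finset.mem_Icc.1 hi).1
  -- integrability and means of the noise terms
  have kA : ∀ i, 1 ≤ i → _ := fun i hi => integrable_noise_sq (P := P) (ip := ip) (σ := σH)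
    hHs.measurable hH ((haux.measurable_r i hi).mono (hle _ _) le_rfl) (hζ (2 * i - 1))
    (haux.r_mem i hi) (indepFun_of_indep (haux.measurable_r i hi)
      (indep_pastSigma_right hξ hζ hindep le_rfl)) (hvH _ (by omega))
  have kB : ∀ i, 1 ≤ i → _ := fun i hi => integrable_noise_sq (P := P) (ip := ip) (σ := σH)
    hHs.measurable hH ((haux.measurable_w i hi).mono (hle _ _) le_rfl) (hζ (2 * i))
    (haux.w_mem i hi) (indepFun_of_indep (haux.measurable_w i hi)
      (indep_pastSigma_right hξ hζ hindep le_rfl)) (hvH _ (by omega))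
  have kC : ∀ i, 1 ≤ i → _ := fun i hi => integrable_noise_sq (P := P) (ip := ip) (σ := σG)
    hGs.measurable hgradG ((haux.measurable_wmd i hi).mono (hle _ _) le_rfl) (hξ i)
    (haux.wmd_mem i hi) (indepFun_of_indep (haux.measurable_wmd i hi)
      (indep_pastSigma_left hξ hζ hindep le_rfl)) (hvG _ hi)
  have kX : ∀ i, 1 ≤ i → _ := fun i hi => integrable_ip_noise (P := P) (ip := ip)
    (p := fun ω => v i ω - r i ω)
    hGs.measurable hgradG ((haux.measurable_wmd i hi).mono (hle _ _) le_rfl)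
    (((haux.measurable_v i hi).sub (haux.measurable_r i hi)).mono (hle _ _) le_rfl) (hξ i)
    (haux.wmd_mem i hi)
    (fun ω => norm_sub_le_of_bregman_le hdgf hV (haux.r_mem i hi ω) (haux.v_mem i hi ω))
    (indepFun_of_indep ((haux.measurable_wmd i hi).prodMk
      ((haux.measurable_v i hi).sub (haux.measurable_r i hi)))
      (indep_pastSigma_left hξ hζ hindep le_rfl))
    (hGs.integrable i hi) (hGs.unbiased i hi) (kC i hi).1
  have lv : ∀ i, 1 ≤ i → Measurable[pastSigma ξ ζ (i + 1) (2 * i)] (v i) := fun i hi =>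
    (haux.measurable_v i hi).mono (pastSigma_mono (by omega) (by omega)) le_rfl
  have kY : ∀ i, 1 ≤ i → _ := fun i hi => integrable_ip_noise (P := P) (ip := ip)
    (p := fun ω => v i ω - p i ω)
    hHs.measurable hH ((haux.measurable_w i hi).mono (hle _ _) le_rfl)
    (((lv i hi).sub (haux.measurable_p i hi)).mono (hle _ _) le_rfl) (hζ (2 * i))
    (haux.w_mem i hi)
    (fun ω => norm_sub_le_of_bregman_le hdgf hV (haux.p_mem i hi ω) (haux.v_mem i hi ω))
    (indepFun_of_indep ((haux.measurable_w i hi).prodMk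
      ((lv i hi).sub (haux.measurable_p i hi)))
      (indep_pastSigma_right hξ hζ hindep le_rfl))
    (hHs.integrable _ (by omega)) (hHs.unbiased _ (by omega)) (kB i hi).1
  have hb : ∀ i, 1 ≤ i → 0 ≤ i * γ i / μ := fun i hi => by
    have : 0 < γ i := hγ ▸ ampGamma_pos hμ hVI.LG_nonneg hVI.LH_nonneg hσG hσH hΩ hpos hi
    positivity
  -- sums
  have sum_int : ∀ {f : ℕ → Ω → ℝ} (c : ℕ → ℝ), (∀ i, 1 ≤ i → Integrable (f i) P) →
      Integrable (fun ω => ∑ i ∈ Finset.Icc 1 t, c i * f i ω) P ∧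
      ∫ ω, ∑ i ∈ Finset.Icc 1 t, c i * f i ω ∂P
        = ∑ i ∈ Finset.Icc 1 t, c i * ∫ ω, f i ω ∂P := by
    intro f c hf
    have h : ∀ i ∈ Finset.Icc 1 t, Integrable (fun ω => c i * f i ω) P := fun i hi =>
      (hf i (mem1 hi)).const_mul _
    refine ⟨integrable_finsetSum _ h, ?_⟩
    rw [integral_finsetSum _ h]
    exact Finset.sum_congr rfl fun i _ => integral_const_mul _ _
  obtain ⟨iA, eA⟩ := sum_int (fun i => 2 / 3 * (i * γ i / μ)) fun i hi => (kA i hi).1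
  obtain ⟨iB, eB⟩ := sum_int (fun i => 3 / 2 * (i * γ i / μ)) fun i hi => (kB i hi).1
  obtain ⟨iC, eC⟩ := sum_int (fun i => 2 * (i * γ i / μ)) fun i hi => (kC i hi).1
  obtain ⟨iX, eX⟩ := sum_int (fun i => (i : ℝ)) fun i hi => (kX i hi).1
  obtain ⟨iY, eY⟩ := sum_int (fun i => (i : ℝ)) fun i hi => (kY i hi).1
  have iAB := iA.add iB
  have iABC := iAB.add iC
  have iABCX := iABC.add iX
  have iAll := iABCX.add iY
  have iR := ((integrable_const (μ := P) (2 * (t / γ t) * ΩZ ^ 2)).add iAll).const_mul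
    (2 / (t * ((t : ℝ) + 1)))
  have hgap := haux.viGap_le hVI hdgf hΩ hV hσG hσH hpos hγ hAMP (by omega : 1 ≤ t)
  have hmeas := measurable_viGap_comp hVI hZ
    ((haux.measurable_wag (t + 1) (by omega)).mono (hle _ _) le_rfl)
    (haux.wag_mem (t + 1) (by omega))
  -- The gap is nonnegative on `Z`, so the integrable pathwise bound dominates it.
  have hint : Integrable (fun ω => viGap ip Z G H J (wag (t + 1) ω)) P := by
    refine iR.mono' hmeas.aestronglyMeasurable (Filter.Eventually.of_forall fun ω => ?_)
    rw [Real.norm_of_nonneg (viGap_nonneg hVI hZ (haux.wag_mem (t + 1) (by omega) ω))]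
    exact hgap ω
  refine ⟨hint, (integral_mono hint iR hgap).trans ?_⟩
  have eR := integral_const_mul (μ := P) (2 / (t * ((t : ℝ) + 1)))
    (fun ω => 2 * (t / γ t) * ΩZ ^ 2 + (∑ i ∈ Finset.Icc 1 t, 2 / 3 * (i * γ i / μ)
          * dualNorm ip (Hs (r i ω) (ζ (2 * i - 1) ω) - H (r i ω)) ^ 2
        + ∑ i ∈ Finset.Icc 1 t, 3 / 2 * (i * γ i / μ)
          * dualNorm ip (Hs (w (i + 1) ω) (ζ (2 * i) ω) - H (w (i + 1) ω)) ^ 2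
        + ∑ i ∈ Finset.Icc 1 t, 2 * (i * γ i / μ)
          * dualNorm ip (Gs (wmd i ω) (ξ i ω) - gradG (wmd i ω)) ^ 2
        + ∑ i ∈ Finset.Icc 1 t, i * ip (Gs (wmd i ω) (ξ i ω) - gradG (wmd i ω)) (v i ω - r i ω)
        + ∑ i ∈ Finset.Icc 1 t, i * ip (Hs (w (i + 1) ω) (ζ (2 * i) ω) - H (w (i + 1) ω))
            (v i ω - p i ω)))
  refine (le_of_eq eR).trans (le_trans ?_
    (le_ampC0 hμ hVI.LG_nonneg hVI.LH_nonneg hσG hσH hΩ ht))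
  refine mul_le_mul_of_nonneg_left ?_ (by positivity)
  have e1 := integral_add (integrable_const (μ := P) (2 * (t / γ t) * ΩZ ^ 2)) iAll
  have e2 := integral_add iABCX iY
  have e3 := integral_add iABC iX
  have e4 := integral_add iAB iC
  have e5 := integral_add iA iB
  simp only [Pi.add_apply] at e1 e2 e3 e4 e5
  rw [e1, e2, e3, e4, e5, eA, eB, eC, eX, eY, ← hγ]
  have zX : ∑ i ∈ Finset.Icc 1 t, (i : ℝ) * ∫ ω, ip (Gs (wmd i ω) (ξ i ω) - gradG (wmd i ω))
      (v i ω - r i ω) ∂P = 0 := Finset.sum_eq_zero fun i hi => by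
    rw [(kX i (mem1 hi)).2, mul_zero]
  have zY : ∑ i ∈ Finset.Icc 1 t, (i : ℝ) * ∫ ω, ip (Hs (w (i + 1) ω) (ζ (2 * i) ω)
      - H (w (i + 1) ω)) (v i ω - p i ω) ∂P = 0 := Finset.sum_eq_zero fun i hi => by
    rw [(kY i (mem1 hi)).2, mul_zero]
  rw [zX, zY, integral_const, probReal_univ, one_smul, add_zero, add_zero]
  gcongr
  -- Termwise, `σH²` has the coefficient `2/3 + 3/2 = 13/6` and `σG²` has `2 ≤ 13/6`.
  rw [Finset.mul_sum, ← Finset.sum_add_distrib, ← Finset.sum_add_distrib]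
  refine Finset.sum_le_sum fun i hi => ?_
  have b0 := hb i (mem1 hi)
  have mA := mul_le_mul_of_nonneg_left (kA i (mem1 hi)).2 b0
  have mB := mul_le_mul_of_nonneg_left (kB i (mem1 hi)).2 b0
  have mC := mul_le_mul_of_nonneg_left (kC i (mem1 hi)).2 b0
  have := mul_nonneg b0 (sq_nonneg σG)
  linarith

lemma measureReal_le_of_subset_union {α : Type*} {m : MeasurableSpace α} {μ : Measure α}
    [IsFiniteMeasure μ] {S A B C D E : Set α} {a b c d e : ℝ} (hA : μ.real A ≤ a)
    (hB : μ.real B ≤ b) (hC : μ.real C ≤ c) (hD : μ.real D ≤ d) (hE : μ.real E ≤ e)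
    (h : S ⊆ A ∪ (B ∪ (C ∪ (D ∪ E)))) : μ.real S ≤ a + (b + (c + (d + e))) :=
  (measureReal_mono h).trans <| (measureReal_union_le _ _).trans <| add_le_add hA <|
    (measureReal_union_le _ _).trans <| add_le_add hB <|
    (measureReal_union_le _ _).trans <| add_le_add hC <|
    (measureReal_union_le _ _).trans <| add_le_add hD hE

/-- The bound on the deviations of the gap. -/
lemma IsAuxiliary.measureReal_viGap_gt_le (hVI : IsVIProblem ip Z G gradG H J LG LH)
    (hdgf : IsDistanceGenerating ip Z μ dgf gradDgf) (hΩ : 0 < ΩZ)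
    (hV : ∀ z₁ ∈ Z, ∀ z₂ ∈ Z, bregman ip dgf gradDgf z₁ z₂ ≤ ΩZ ^ 2)
    (hξ : ∀ i, Measurable (ξ i)) (hζ : ∀ i, Measurable (ζ i))
    (hindep : iIndepFun (Sum.elim ξ ζ) P)
    (hGs : IsUnbiasedOracle P Z gradG Gs ξ) (hHs : IsUnbiasedOracle P Z H Hs ζ)
    (hgradG : Measurable gradG) (hH : Measurable H)
    (hσG : 0 ≤ σG) (hσH : 0 ≤ σH) (hpos : 0 < LG + LH + σG + σH)
    (hγ : γ = ampGamma μ LG LH σG σH ΩZ)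
    (hAMP : IsStochasticAMP ip Z dgf gradDgf J Gs Hs ξ ζ ampAlpha γ r₁ r w wag wmd)
    (haux : IsAuxiliary ip Z dgf gradDgf gradG H J Gs Hs ξ ζ γ r w wag wmd p v)
    (hlG : HasLightTail P ip Z gradG Gs ξ σG) (hlH : HasLightTail P ip Z H Hs ζ σH)
    {t : ℕ} (ht : 2 ≤ t) {lam : ℝ} (hlam : 0 < lam) :
    P.real {ω | viGap ip Z G H J (wag (t + 1) ω)
        > ampC0 μ LG LH σG σH ΩZ t + lam * ampC1 μ σG σH ΩZ t}
      ≤ 2 * Real.exp (-lam ^ 2 / 3) + 3 * Real.exp (-lam) := by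
  have hμ := hdgf.mu_pos
  have hle : ∀ a b, pastSigma ξ ζ a b ≤ mΩ := fun a b => pastSigma_le hξ hζ
  have hb : ∀ i, 1 ≤ i → 0 ≤ i * γ i / μ := fun i hi => by
    have : 0 < γ i := hγ ▸ ampGamma_pos hμ hVI.LG_nonneg hVI.LH_nonneg hσG hσH hΩ hpos hi
    positivity
  have hR : 0 < Real.sqrt (2 * ΩZ ^ 2 / μ) := Real.sqrt_pos.2 (by positivity)
  have hA := measureReal_sum_sq_noise_gt_le (P := P) (ip := ip) (σ := σH) (x := r)
    (X := fun i => ζ (2 * i - 1)) hHs.measurable hH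
    (fun i hi => (haux.measurable_r i hi).mono (hle _ _) le_rfl) (fun i _ => hζ _)
    (fun i hi => indepFun_of_indep (haux.measurable_r i hi)
      (indep_pastSigma_right hξ hζ hindep le_rfl)) haux.r_mem
    (fun i hi => hlH _ (by omega)) (b := fun i => 2 / 3 * (i * γ i / μ))
    (fun i hi => mul_nonneg (by norm_num) (hb i hi)) t lam
  have hB := measureReal_sum_sq_noise_gt_le (P := P) (ip := ip) (σ := σH)
    (x := fun i => w (i + 1)) (X := fun i => ζ (2 * i)) hHs.measurable hH
    (fun i hi => (haux.measurable_w i hi).mono (hle _ _) le_rfl) (fun i _ => hζ _)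
    (fun i hi => indepFun_of_indep (haux.measurable_w i hi)
      (indep_pastSigma_right hξ hζ hindep le_rfl)) haux.w_mem
    (fun i hi => hlH _ (by omega)) (b := fun i => 3 / 2 * (i * γ i / μ))
    (fun i hi => mul_nonneg (by norm_num) (hb i hi)) t lam
  have hC := measureReal_sum_sq_noise_gt_le (P := P) (ip := ip) (σ := σG) (x := wmd) (X := ξ)
    hGs.measurable hgradG
    (fun i hi => (haux.measurable_wmd i hi).mono (hle _ _) le_rfl) (fun i _ => hξ _)
    (fun i hi => indepFun_of_indep (haux.measurable_wmd i hi)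
      (indep_pastSigma_left hξ hζ hindep le_rfl)) haux.wmd_mem
    hlG (b := fun i => 2 * (i * γ i / μ))
    (fun i hi => mul_nonneg (by norm_num) (hb i hi)) t lam
  have hX := measureReal_sum_noise_gt_le (P := P) (ip := ip) (σ := σG) (x := wmd) (X := ξ)
    (p := fun i ω => v i ω - r i ω) (R := Real.sqrt (2 * ΩZ ^ 2 / μ))
    (𝓕 := fun i => pastSigma ξ ζ i (2 * i - 1)) hGs.measurable hgradG
    (fun i => pastSigma_mono (by omega) (by omega)) (fun i => hle _ _)
    haux.measurable_wmd (fun i hi => (haux.measurable_v i hi).sub (haux.measurable_r i hi))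
    (fun i _ => measurable_pastSigma_left (by omega))
    (fun i _ => indep_pastSigma_left hξ hζ hindep le_rfl) haux.wmd_mem
    (fun i hi ω => norm_sub_le_of_bregman_le hdgf hV (haux.r_mem i hi ω) (haux.v_mem i hi ω))
    hGs hlG hσG hR (by omega : 1 ≤ t) hlam
  have hY := measureReal_sum_noise_gt_le (P := P) (ip := ip) (σ := σH)
    (x := fun i => w (i + 1)) (X := fun i => ζ (2 * i))
    (p := fun i ω => v i ω - p i ω) (R := Real.sqrt (2 * ΩZ ^ 2 / μ))
    (𝓕 := fun i => pastSigma ξ ζ (i + 1) (2 * i)) hHs.measurable hH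
    (fun i => pastSigma_mono (by omega) (by omega)) (fun i => hle _ _)
    haux.measurable_w (fun i hi => ((haux.measurable_v i hi).mono
      (pastSigma_mono (by omega) (by omega)) le_rfl).sub (haux.measurable_p i hi))
    (fun i _ => measurable_pastSigma_right (by omega))
    (fun i _ => indep_pastSigma_right hξ hζ hindep le_rfl) haux.w_mem
    (fun i hi ω => norm_sub_le_of_bregman_le hdgf hV (haux.p_mem i hi ω) (haux.v_mem i hi ω))
    (hHs.comp fun i hi => by omega) (fun i hi => hlH _ (by omega)) hσH hR
    (by omega : 1 ≤ t) hlam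
  have hgap := haux.viGap_le hVI hdgf hΩ hV hσG hσH hpos hγ hAMP (by omega : 1 ≤ t)
  have h0 := le_ampC0 hμ hVI.LG_nonneg hVI.LH_nonneg hσG hσH hΩ ht
  have h1 := le_ampC1 hμ hVI.LG_nonneg hVI.LH_nonneg hσG hσH hΩ ht
  rw [← hγ] at h0 h1
  have hS : ∑ i ∈ Finset.Icc 1 t, 2 / 3 * (i * γ i / μ) * σH ^ 2
      + ∑ i ∈ Finset.Icc 1 t, 3 / 2 * (i * γ i / μ) * σH ^ 2
      + ∑ i ∈ Finset.Icc 1 t, 2 * (i * γ i / μ) * σG ^ 2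
      ≤ 13 / 6 * ∑ i ∈ Finset.Icc 1 t, (i * γ i / μ * (σH ^ 2 + σG ^ 2)) := by
    rw [Finset.mul_sum, ← Finset.sum_add_distrib, ← Finset.sum_add_distrib]
    refine Finset.sum_le_sum fun i hi => ?_
    have := mul_nonneg (hb i (Finset.mem_Icc.1 hi).1) (sq_nonneg σG)
    linarith
  -- Outside the five exceptional events every noise sum is below its threshold, and the pathwise
  -- bound applies.
  refine le_trans (measureReal_le_of_subset_union hA hB hC hX hY ?_) (by linarith)
  intro ω hω
  by_contra hcon
  rw [Set.mem_union, Set.mem_union, Set.mem_union, Set.mem_union, not_or, not_or, not_or,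
    not_or] at hcon
  obtain ⟨nA, nB, nC, nX, nY⟩ := hcon
  have nA' := not_lt.1 (show ¬ (1 + lam) * ∑ i ∈ Finset.Icc 1 t, 2 / 3 * (i * γ i / μ) * σH ^ 2
    < ∑ i ∈ Finset.Icc 1 t, 2 / 3 * (i * γ i / μ)
        * dualNorm ip (Hs (r i ω) (ζ (2 * i - 1) ω) - H (r i ω)) ^ 2 from nA)
  have nB' := not_lt.1 (show ¬ (1 + lam) * ∑ i ∈ Finset.Icc 1 t, 3 / 2 * (i * γ i / μ) * σH ^ 2
    < ∑ i ∈ Finset.Icc 1 t, 3 / 2 * (i * γ i / μ)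
        * dualNorm ip (Hs (w (i + 1) ω) (ζ (2 * i) ω) - H (w (i + 1) ω)) ^ 2 from nB)
  have nC' := not_lt.1 (show ¬ (1 + lam) * ∑ i ∈ Finset.Icc 1 t, 2 * (i * γ i / μ) * σG ^ 2
    < ∑ i ∈ Finset.Icc 1 t, 2 * (i * γ i / μ)
        * dualNorm ip (Gs (wmd i ω) (ξ i ω) - gradG (wmd i ω)) ^ 2 from nC)
  have nX' := not_lt.1 (show ¬ lam * (σG * (Real.sqrt (2 * ΩZ ^ 2 / μ)
      * Real.sqrt (4 / 3 * ∑ i ∈ Finset.Icc 1 t, (i : ℝ) ^ 2)))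
    < ∑ i ∈ Finset.Icc 1 t, i * ip (Gs (wmd i ω) (ξ i ω) - gradG (wmd i ω))
        (v i ω - r i ω) from nX)
  have nY' := not_lt.1 (show ¬ lam * (σH * (Real.sqrt (2 * ΩZ ^ 2 / μ)
      * Real.sqrt (4 / 3 * ∑ i ∈ Finset.Icc 1 t, (i : ℝ) ^ 2)))
    < ∑ i ∈ Finset.Icc 1 t, i * ip (Hs (w (i + 1) ω) (ζ (2 * i) ω) - H (w (i + 1) ω))
        (v i ω - p i ω) from nY)
  refine absurd hω (not_lt.2 ((hgap ω).trans ?_))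
  -- The squared noises enter with the factor `1 + λ`: the `1` is accounted for in `𝒞₀`, the `λ`
  -- together with the paired noises in `λ 𝒞₁`.
  have h1' := mul_le_mul_of_nonneg_left h1 hlam.le
  have hS' := mul_le_mul_of_nonneg_left hS (by linarith : 0 ≤ 1 + lam)
  refine le_trans ?_ (add_le_add h0 h1')
  rw [mul_left_comm lam, ← mul_add]
  refine mul_le_mul_of_nonneg_left ?_ (by positivity)
  linarith

end Bounds

theorem mainTheorem6 {E Ω Ξ : Type*} [NormedAddCommGroup E] [NormedSpace ℝ E]
    [FiniteDimensional ℝ E] [MeasurableSpace E] [BorelSpace E]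
    [MeasurableSpace Ω] [MeasurableSpace Ξ] (P : Measure Ω) [IsProbabilityMeasure P]
    (ip : E →L[ℝ] E →L[ℝ] ℝ) (hip : IsInnerProduct ip)
    (Z : Set E) (G : E → ℝ) (gradG H : E → E) (J : E → ℝ) (LG LH : ℝ)
    (hVI : IsVIProblem ip Z G gradG H J LG LH)
    (μ : ℝ) (dgf : E → ℝ) (gradDgf : E → E)
    (hdgf : IsDistanceGenerating ip Z μ dgf gradDgf)
    (ΩZ : ℝ) (hΩZ : 0 < ΩZ)
    (hV : ∀ z₁ ∈ Z, ∀ z₂ ∈ Z, bregman ip dgf gradDgf z₁ z₂ ≤ ΩZ ^ 2)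
    (ξ ζ : ℕ → Ω → Ξ) (hξ : ∀ i, Measurable (ξ i)) (hζ : ∀ i, Measurable (ζ i))
    (hindep : iIndepFun (Sum.elim ξ ζ) P)
    (Gs Hs : E → Ξ → E)
    (hGs : IsUnbiasedOracle P Z gradG Gs ξ) (hHs : IsUnbiasedOracle P Z H Hs ζ)
    (σG σH : ℝ) (hσG : 0 ≤ σG) (hσH : 0 ≤ σH)
    (hpos : 0 < LG + LH + σG + σH)
    (r₁ : E) (r w wag wmd : ℕ → Ω → E)
    (hAMP : IsStochasticAMP ip Z dgf gradDgf J Gs Hs ξ ζ ampAlpha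
      (ampGamma μ LG LH σG σH ΩZ) r₁ r w wag wmd) :
    (∀ x ∈ Z, BddAbove ((fun u => viQ ip G H J x u) '' Z)) ∧
    (HasBoundedVariance P ip Z gradG Gs ξ σG → HasBoundedVariance P ip Z H Hs ζ σH →
      ∀ t : ℕ, 2 ≤ t →
        Integrable (fun ω => viGap ip Z G H J (wag (t + 1) ω)) P ∧
        ∫ ω, viGap ip Z G H J (wag (t + 1) ω) ∂P ≤ ampC0 μ LG LH σG σH ΩZ t) ∧
    (HasLightTail P ip Z gradG Gs ξ σG → HasLightTail P ip Z H Hs ζ σH →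
      ∀ t : ℕ, 2 ≤ t → ∀ lam : ℝ, 0 < lam →
        P.real {ω | viGap ip Z G H J (wag (t + 1) ω)
            > ampC0 μ LG LH σG σH ΩZ t + lam * ampC1 μ σG σH ΩZ t}
          ≤ 2 * Real.exp (-lam ^ 2 / 3) + 3 * Real.exp (-lam)) := by
  -- The gradient and the operator are replaced by measurable versions agreeing with them on `Z`;
  -- hypotheses and gap function involve only their values on `Z`.
  obtain ⟨gradG', hgradG', eG⟩ := exists_measurable_extension hVI.isClosed hVI.continuousOn_grad
  obtain ⟨H', hH', eH⟩ := exists_measurable_extension hVI.isClosed (hVI.continuousOn_operator hip)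
  have hZ := isCompact_of_bregman_le hVI.isClosed hdgf hV
  have hVI' : IsVIProblem ip Z G gradG' H' J LG LH :=
    { hVI with
      hasGradient := fun v hv => by rw [eG v hv]; exact hVI.hasGradient v hv
      continuousOn_grad := hVI.continuousOn_grad.congr eG
      bregman_nonneg := fun w hw v hv => by rw [eG v hv]; exact hVI.bregman_nonneg w hw v hv
      bregman_le := fun w hw v hv => by rw [eG v hv]; exact hVI.bregman_le w hw v hv
      monotone := fun w hw v hv => by rw [eH w hw, eH v hv]; exact hVI.monotone w hw v hv
      lipschitz := fun w hw v hv => by rw [eH w hw, eH v hv]; exact hVI.lipschitz w hw v hv }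
  have hgap : ∀ x, viGap ip Z G H' J x = viGap ip Z G H J x := fun x => by
    unfold viGap
    rw [Set.image_congr fun u hu => ?_]
    simp only [viQ, eH u hu]
  have hγ : ∀ t, 1 ≤ t → 0 ≤ ampGamma μ LG LH σG σH ΩZ t := fun t ht =>
    (ampGamma_pos hdgf.mu_pos hVI.LG_nonneg hVI.LH_nonneg hσG hσH hΩZ (by linarith) ht).le
  obtain ⟨p, v, haux⟩ := exists_isAuxiliary hVI' hdgf hZ hgradG' hH' hGs.measurable
    hHs.measurable hγ hAMP
  refine ⟨fun x _ => bddAbove_viQ hVI hZ x, fun hvG hvH t ht => ?_,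
    fun hlG hlH t ht lam hlam => ?_⟩
  · have := haux.integral_viGap_le hVI' hdgf hΩZ hV hξ hζ hindep (hGs.congr eG) (hHs.congr eH)
      hgradG' hH' hσG hσH hpos rfl hAMP
      (fun i hi x hx => by rw [eG x hx]; exact hvG i hi x hx)
      (fun i hi x hx => by rw [eH x hx]; exact hvH i hi x hx) ht
    simpa only [hgap] using this
  · have := haux.measureReal_viGap_gt_le hVI' hdgf hΩZ hV hξ hζ hindep (hGs.congr eG)
      (hHs.congr eH) hgradG' hH' hσG hσH hpos rfl hAMP
      (fun i hi x hx => by rw [eG x hx]; exact hlG i hi x hx)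
      (fun i hi x hx => by rw [eH x hx]; exact hlH i hi x hx) ht hlam
    simpa only [hgap] using this
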